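/- **Setting.** Let $p_1=(0,0)$, $p_2=(\tfrac12,\tfrac{\sqrt3}2)$, $p_3=(1,0)$, let $T\subset\mathbb R^2$ be the triangle (union of three edges) with these vertices, and let $f_j(x)=\tfrac12(x-p_j)+p_j$, $j=1,2,3$. For a word $w=w_1\cdots w_n\in\{1,2,3\}^n$ put $f_w=f_{w_n}\circ\cdots\circ f_{w_1}$, and let $SG=\overline{\bigcup_{n\ge0}\bigcup_{|w|=n}f_w(T)}$ be the Sierpinski gasket with the Euclidean metric. Let $\mathcal H$ be the $\log_2 3$-dimensional Hausdorff measure on $SG$, normalized to be a probability measure. Let $V_n=\bigcup_{|w|=n}f_w(\{p_1,p_2,p_3\})$ and, for $u:V_n\to\mathbb R$, let $E_n(u)=\sum_{\{x,y\}}(u(x)-u(y))^2$, the sum being over all edges $\{x,y\}$ of the triangles $f_w(T)$, $|w|=n$. For $j=1,2,3$ let $h_j:SG\to\mathbb R$ be the continuous function with $h_j(p_k)=\delta_{jk}$ which is harmonic, that is, for every $n$ its restriction to $V_n$ minimizes $E_n$ among all functions on $V_n$ with the same values at $p_1,p_2,p_3$. Define $$\Phi:SG\to\mathbb R^3,\qquad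 \Phi(x)=\tfrac1{\sqrt2}\Big((h_1(x),h_2(x),h_3(x))-\tfrac13(1,1,1)\Big),$$ and let $K_H=\Phi(SG)$ be the harmonic Sierpinski gasket, endowed with the geodesic metric ($d_{geo}(x,y)$ is the infimum of the lengths of the curves in $K_H$ from $x$ to $y$). Let $C(K_H)$ be the space of continuous functions $K_H\to\mathbb C$. Let $Z=\{x+y+z=0\}\subset\mathbb R^3$, let $P$ be the orthogonal projection of $\mathbb R^3$ onto $Z$, let $b_1,b_2,b_3$ be the standard basis, let $q_j=\tfrac{3}{\sqrt6}P(b_j)$ (a unit vector), let $M_j:Z\to Z$ be the linear map which multiplies $q_j$ by $\tfrac35$ and the vectors of $Z$ orthogonal to $q_j$ by $\tfrac15$, and let $$H_j(x)=M_j\big(x-\tfrac1{\sqrt2}P(b_j)\big)+\tfrac1{\sqrt2}P(b_j).$$ For $n\ge0$ let $x_{n,k,j}$, $j=1,2,3$, be the midpoints of the edges of the $3^n$ triangles $\Delta_{n,k}$ of the form $f_w(T)$, $|w|=n$, and let $$\psi_n(g)=\frac1{3^{n+1}}\sum_{k=1}^{3^n}\sum_{j=1}^3 g(x_{n,k,j}),\qquad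 \tilde\psi_n(h)=\psi_n(h\circ\Phi)\quad(h\in C(K_H)).$$ **Proposition.** The sequence $(\tilde\psi_n)$ converges, in the weak-* topology on the dual of $C(K_H)$, to the positive linear functional $$\tilde\psi(h)=\int_{SG}h\circ\Phi\,d\mathcal H=\int_{K_H}h\,d(\mathcal H\circ\Phi^{-1}),\qquad h\in C(K_H)$$ (in particular $h\circ\Phi$ is $\mathcal H$-integrable and $\tilde\psi$ is continuous). Moreover each $H_j$ maps $K_H$ continuously into itself, and $$\tilde\psi(h)=\frac13\sum_{j=1}^3\tilde\psi(h\circ H_j)\qquad\text{for all }h\in C(K_H).$$ -/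

import Mathlib

open Set Filter Topology MeasureTheory
open scoped ENNReal ComplexOrder

noncomputable section

namespace HarmonicGasket

/-- The Euclidean plane. -/
abbrev E2 := EuclideanSpace ℝ (Fin 2)

/-- Euclidean three-space. -/
abbrev E3 := EuclideanSpace ℝ (Fin 3)

/-! ### The classical Sierpinski gasket -/

/-- The vertices `p 0`, `p 1`, `p 2` of the initial equilateral triangle. -/
def p : Fin 3 → E2 :=
  ![!₂[0, 0], !₂[1 / 2, Real.sqrt 3 / 2], !₂[1, 0]]

/-- The contractions `f j x = (1 / 2) (x - p j) + p j`. -/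
def f (j : Fin 3) : E2 →ᵃ[ℝ] E2 := AffineMap.homothety (p j) (1 / 2 : ℝ)

theorem f_apply (j : Fin 3) (x : E2) : f j x = (1 / 2 : ℝ) • (x - p j) + p j := by
  simp [f, AffineMap.homothety_apply]

/-- The composition `f (w n) ∘ ⋯ ∘ f (w 1)` along a word `w` of length `n`. -/
def fWord : (n : ℕ) → (Fin n → Fin 3) → (E2 →ᵃ[ℝ] E2)
  | 0, _ => AffineMap.id ℝ E2
  | n + 1, w => (f (w (Fin.last n))).comp (fWord n (fun i => w i.castSucc))

/-- The triangle `T` (as a graph: the union of its three edges). -/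
def T : Set E2 := ⋃ j : Fin 3, segment ℝ (p (j + 1)) (p (j + 2))

/-- The level `n` graph approximation. -/
def SGgraph (n : ℕ) : Set E2 := ⋃ w : Fin n → Fin 3, fWord n w '' T

/-- The Sierpinski gasket. -/
def SG : Set E2 := closure (⋃ n, SGgraph n)

theorem fWord_mem_SG {n : ℕ} (w : Fin n → Fin 3) {x : E2} (hx : x ∈ T) : fWord n w x ∈ SG :=
  subset_closure (mem_iUnion.2 ⟨n, mem_iUnion.2 ⟨w, mem_image_of_mem _ hx⟩⟩)

theorem p_mem_T (k : Fin 3) : p k ∈ T := by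
  refine mem_iUnion.2 ⟨k + 2, ?_⟩
  have : k + 2 + 1 = k := by fin_cases k <;> rfl
  rw [this]
  exact left_mem_segment ℝ _ _

theorem midpoint_mem_T (j : Fin 3) : midpoint ℝ (p (j + 1)) (p (j + 2)) ∈ T :=
  mem_iUnion.2 ⟨j, midpoint_mem_segment _ _⟩

/-- The vertices of the level `n` triangles, as points of the gasket. -/
def vertex {n : ℕ} (w : Fin n → Fin 3) (k : Fin 3) : SG :=
  ⟨fWord n w (p k), fWord_mem_SG w (p_mem_T k)⟩

/-- The midpoints of the edges of the level `n` triangles, as points of the gasket: the index `j`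
stands for the edge opposite to the `j`-th vertex. -/
def edgeMidpoint {n : ℕ} (w : Fin n → Fin 3) (j : Fin 3) : SG :=
  ⟨midpoint ℝ (fWord n w (p (j + 1))) (fWord n w (p (j + 2))), by
    rw [← AffineMap.map_midpoint]
    exact fWord_mem_SG w (midpoint_mem_T j)⟩

/-- The `log 3 / log 2`-dimensional Hausdorff measure of the gasket (with its Euclidean metric),
normalized to total mass one. -/
def hausdorffProb : Measure SG :=
  (μH[Real.logb 2 3] (univ : Set SG))⁻¹ • (μH[Real.logb 2 3] : Measure SG)

/-! ### Harmonic functions on the gasket -/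

/-- The energy of level `n`: the sum of `(u x - u y) ^ 2` over all edges `{x, y}` of the level `n`
graph. Distinct triangles of level `n` have at most one common vertex, so that each edge belongs to
exactly one word `w` and one index `j`. -/
def energy (n : ℕ) (u : SG → ℝ) : ℝ :=
  ∑ w : Fin n → Fin 3, ∑ j : Fin 3, (u (vertex w (j + 1)) - u (vertex w (j + 2))) ^ 2

/-- The three corners of the gasket. -/
def corner (k : Fin 3) : SG := vertex (n := 0) Fin.elim0 k

theorem coe_corner (k : Fin 3) : (corner k : E2) = p k := rfl

/-- A continuous function on the gasket is harmonic if its restriction to the vertices of each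
level minimizes the energy of that level, given its values at the three corners. (The energy of
level `n` involves only the values of `v` at the vertices of level `n`, and `v` is arbitrary.) -/
def IsHarmonic (u : SG → ℝ) : Prop :=
  Continuous u ∧
    ∀ n : ℕ, ∀ v : SG → ℝ, (∀ k, v (corner k) = u (corner k)) → energy n u ≤ energy n v

/-- `harmonicBasis j` is the harmonic function with value `1` at the `j`-th corner and `0` at the
two other corners. -/
def harmonicBasis (j : Fin 3) : SG → ℝ :=
  Classical.epsilon fun u : SG → ℝ =>
    IsHarmonic u ∧ ∀ k, u (corner k) = if k = j then 1 else 0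

/-! ### The harmonic gasket -/

/-- The map `Φ = (1 / √2) ((h₁, h₂, h₃) - (1 / 3) (1, 1, 1))`. -/
def Phi (x : SG) : E3 :=
  (1 / Real.sqrt 2) •
    (!₂[harmonicBasis 0 x, harmonicBasis 1 x, harmonicBasis 2 x] - (1 / 3 : ℝ) • !₂[1, 1, 1])

/-- The length of a curve is its total variation; the intrinsic (geodesic) distance in a set `K` is
the infimum of the lengths of the curves in `K` that join two points (`∞` if there is none). -/
def geodesicEDist (K : Set E3) (x y : E3) : ℝ≥0∞ :=
  sInf {L | ∃ (γ : ℝ → E3) (a b : ℝ), a ≤ b ∧ ContinuousOn γ (Icc a b) ∧ MapsTo γ (Icc a b) K ∧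
    γ a = x ∧ γ b = y ∧ L = eVariationOn γ (Icc a b)}

theorem geodesicEDist_self {K : Set E3} {x : E3} (hx : x ∈ K) : geodesicEDist K x x = 0 := by
  refine le_antisymm (sInf_le ⟨fun _ => x, 0, 0, le_rfl, continuousOn_const, fun _ _ => hx, rfl,
    rfl, ?_⟩) zero_le
  rw [eVariationOn.subsingleton]
  simp

theorem geodesicEDist_comm_le (K : Set E3) (x y : E3) :
    geodesicEDist K y x ≤ geodesicEDist K x y := by
  refine le_sInf ?_
  rintro L ⟨γ, a, b, hab, hc, hm, rfl, rfl, rfl⟩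
  have hmaps : MapsTo (fun t : ℝ => -t) (Icc (-b) (-a)) (Icc a b) := fun t ht =>
    ⟨by linarith [ht.2], by linarith [ht.1]⟩
  refine sInf_le ⟨fun t => γ (-t), -b, -a, by linarith,
    hc.comp continuous_neg.continuousOn hmaps, hm.comp hmaps, by simp, by simp, ?_⟩
  have h := eVariationOn.comp_eq_of_antitoneOn γ (t := Icc (-b) (-a)) (fun t : ℝ => -t)
    (fun s _ t _ hst => neg_le_neg hst)
  have himg : (fun t : ℝ => -t) '' Icc (-b) (-a) = Icc a b := by simp
  rw [himg] at h
  exact h.symm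

theorem geodesicEDist_triangle (K : Set E3) (x y z : E3) :
    geodesicEDist K x z ≤ geodesicEDist K x y + geodesicEDist K y z := by
  have key : ∀ L ∈ {L | ∃ (γ : ℝ → E3) (a b : ℝ), a ≤ b ∧ ContinuousOn γ (Icc a b) ∧
      MapsTo γ (Icc a b) K ∧ γ a = x ∧ γ b = y ∧ L = eVariationOn γ (Icc a b)},
      ∀ L' ∈ {L | ∃ (γ : ℝ → E3) (a b : ℝ), a ≤ b ∧ ContinuousOn γ (Icc a b) ∧
      MapsTo γ (Icc a b) K ∧ γ a = y ∧ γ b = z ∧ L = eVariationOn γ (Icc a b)},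
      geodesicEDist K x z ≤ L + L' := by
    rintro L ⟨γ, a, b, hab, hc, hm, hx, hy, rfl⟩ L' ⟨γ', c, d, hcd, hc', hm', hy', hz, rfl⟩
    set e : ℝ := b + (d - c) with he
    have hbe : b ≤ e := by linarith
    set δ : ℝ → E3 := fun t => if t ≤ b then γ t else γ' (t - b + c) with hδ
    have h1 : EqOn δ γ (Icc a b) := fun t ht => by simp [hδ, ht.2]
    have h2 : EqOn δ (γ' ∘ fun t => t - b + c) (Icc b e) := fun t ht => by
      rcases eq_or_lt_of_le ht.1 with h | h
      · subst h
        simp [hδ, hy, hy']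
      · simp [hδ, not_le.2 h]
    have hmaps : MapsTo (fun t : ℝ => t - b + c) (Icc b e) (Icc c d) := fun t ht =>
      ⟨by linarith [ht.1], by linarith [ht.2]⟩
    have himg : (fun t : ℝ => t - b + c) '' Icc b e = Icc c d := by
      refine Subset.antisymm hmaps.image_subset fun t ht => ?_
      exact ⟨t - c + b, ⟨by linarith [ht.1], by linarith [ht.2]⟩, by ring⟩
    have hvar : eVariationOn δ (Icc b e) = eVariationOn γ' (Icc c d) := by
      rw [eVariationOn.congr h2, ← himg]
      exact eVariationOn.comp_eq_of_monotoneOn γ' _ (fun s _ t _ hst => by simpa using hst)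
    have hun : Icc a e = Icc a b ∪ Icc b e := (Icc_union_Icc_eq_Icc hab hbe).symm
    refine sInf_le ⟨δ, a, e, hab.trans hbe, ?_, ?_, ?_, ?_, ?_⟩
    · rw [hun]
      refine ContinuousOn.union_of_isClosed (hc.congr h1) (ContinuousOn.congr ?_ h2)
        isClosed_Icc isClosed_Icc
      exact hc'.comp (by fun_prop) hmaps
    · rw [hun]
      refine MapsTo.union (hm.congr h1.symm) ((hm'.comp hmaps).congr h2.symm)
    · rw [h1 ⟨le_rfl, hab⟩, hx]
    · rw [h2 ⟨hbe, le_rfl⟩]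
      simp [he, hz]
    · have h := eVariationOn.Icc_add_Icc δ (s := univ) hab hbe (mem_univ b)
      simp only [univ_inter] at h
      rw [← h, hvar, eVariationOn.congr h1]
  conv_rhs => rw [geodesicEDist, geodesicEDist, sInf_eq_iInf, sInf_eq_iInf]
  exact ENNReal.le_iInf₂_add_iInf₂ key

theorem edist_le_geodesicEDist (K : Set E3) (x y : E3) : edist x y ≤ geodesicEDist K x y := by
  refine le_sInf ?_
  rintro L ⟨γ, a, b, hab, -, -, rfl, rfl, rfl⟩
  exact eVariationOn.edist_le γ ⟨le_rfl, hab⟩ ⟨hab, le_rfl⟩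

/-- The points of the harmonic gasket `Φ(SG)`. -/
structure KH where
  /-- The point in three-space. -/
  pt : E3
  /-- The point lies in the image of `Φ`. -/
  mem : pt ∈ range Phi

/-- The harmonic gasket carries its geodesic metric. -/
instance : EMetricSpace KH where
  edist x y := geodesicEDist (range Phi) x.pt y.pt
  edist_self x := geodesicEDist_self x.mem
  edist_comm x y := le_antisymm (geodesicEDist_comm_le _ _ _) (geodesicEDist_comm_le _ _ _)
  edist_triangle x y z := geodesicEDist_triangle _ _ _ _
  eq_of_edist_eq_zero := by
    rintro ⟨x, hx⟩ ⟨y, hy⟩ h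
    have : x = y := edist_le_zero.1 ((edist_le_geodesicEDist _ x y).trans h.le)
    subst this
    rfl

instance : MeasurableSpace KH := borel KH

instance : BorelSpace KH := ⟨rfl⟩

/-- The bijection `Φ`, as a map to the harmonic gasket. -/
def toKH (x : SG) : KH := ⟨Phi x, mem_range_self x⟩

/-! ### The affine maps of the harmonic gasket -/

/-- The plane `x + y + z = 0`. -/
def Z : Submodule ℝ E3 where
  carrier := {v | v 0 + v 1 + v 2 = 0}
  add_mem' := by
    intro a b ha hb
    simp only [mem_ofPred_eq, PiLp.add_apply] at *
    linarith
  zero_mem' := by simp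
  smul_mem' := by
    intro c a ha
    simp only [mem_ofPred_eq, PiLp.smul_apply, smul_eq_mul] at *
    rw [← mul_add, ← mul_add, ha, mul_zero]

/-- The orthogonal projection of the `j`-th standard basis vector onto `Z`, i.e. the `j`-th column
of the matrix `(1 / 3) [2, -1, -1; -1, 2, -1; -1, -1, 2]`. -/
def Pb : Fin 3 → E3 :=
  ![!₂[2 / 3, -1 / 3, -1 / 3], !₂[-1 / 3, 2 / 3, -1 / 3], !₂[-1 / 3, -1 / 3, 2 / 3]]

/-- The unit vector `q j = (3 / √6) P(b j)`. -/
def q (j : Fin 3) : E3 := (3 / Real.sqrt 6) • Pb j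

/-- The linear map `M j`; on `Z` it is the map with eigenvector `q j` for the eigenvalue `3 / 5` and
with eigenvalue `1 / 5` on the orthogonal complement of `q j` in `Z`, see the three lemmas below. -/
def M (j : Fin 3) : E3 →ₗ[ℝ] E3 :=
  (1 / 5 : ℝ) • LinearMap.id + (2 / 5 : ℝ) • (innerₛₗ ℝ (q j)).smulRight (q j)

theorem M_apply (j : Fin 3) (v : E3) : M j v = (1 / 5 : ℝ) • v + (2 / 5 * inner ℝ (q j) v) • q j := by
  simp [M, smul_smul]

theorem Pb_mem_Z (j : Fin 3) : Pb j ∈ Z := by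
  change (Pb j) 0 + (Pb j) 1 + (Pb j) 2 = 0
  fin_cases j <;> norm_num [Pb, Matrix.cons_val_two, Matrix.vecHead, Matrix.vecTail]

theorem q_mem_Z (j : Fin 3) : q j ∈ Z := Z.smul_mem _ (Pb_mem_Z j)

theorem inner_q_self (j : Fin 3) : inner ℝ (q j) (q j) = (1 : ℝ) := by
  have h6 : Real.sqrt 6 * Real.sqrt 6 = 6 := Real.mul_self_sqrt (by norm_num)
  have h : inner ℝ (Pb j) (Pb j) = (2 / 3 : ℝ) := by
    fin_cases j <;>
      norm_num [Pb, PiLp.inner_apply, Fin.sum_univ_three, Matrix.cons_val_two, Matrix.vecHead,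
        Matrix.vecTail, -inner_self_eq_norm_sq_to_K]
  rw [q, real_inner_smul_left, real_inner_smul_right, h]
  have : (3 / Real.sqrt 6) * (3 / Real.sqrt 6) = 9 / 6 := by
    rw [div_mul_div_comm, h6]; norm_num
  rw [← mul_assoc, this]
  norm_num

theorem M_mem_Z (j : Fin 3) {v : E3} (hv : v ∈ Z) : M j v ∈ Z := by
  rw [M_apply]
  exact Z.add_mem (Z.smul_mem _ hv) (Z.smul_mem _ (q_mem_Z j))

theorem M_q (j : Fin 3) : M j (q j) = (3 / 5 : ℝ) • q j := by
  rw [M_apply, inner_q_self, ← add_smul]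
  norm_num

theorem M_orthogonal (j : Fin 3) {v : E3} (hv : inner ℝ (q j) v = (0 : ℝ)) :
    M j v = (1 / 5 : ℝ) • v := by
  rw [M_apply, hv]
  simp

/-- The fixed point `(1 / √2) P(b j)` of `H j`. It is the `j`-th corner `Φ(p j)` of the harmonic
gasket and a positive multiple of `q j`. -/
def cornerH (j : Fin 3) : E3 := (1 / Real.sqrt 2) • Pb j

/-- The contractive affine maps `H j` that determine the harmonic gasket. -/
def H (j : Fin 3) (x : E3) : E3 := M j (x - cornerH j) + cornerH j

/-! ### The averaging functionals -/

/-- The average of `g` over the midpoints of the edges of the `3 ^ n` triangles of level `n`. -/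
def psi (n : ℕ) (g : SG → ℂ) : ℂ :=
  1 / 3 ^ (n + 1) * ∑ w : Fin n → Fin 3, ∑ j : Fin 3, g (edgeMidpoint w j)

/-- The functional `h ↦ psi n (h ∘ Φ)` in the dual of `C(KH)`, with the weak-* topology. -/
def psiTilde (n : ℕ) : WeakDual ℂ C(KH, ℂ) :=
  StrongDual.toWeakDual ((1 / 3 ^ (n + 1) : ℂ) •
    ∑ w : Fin n → Fin 3, ∑ j : Fin 3, ContinuousMap.evalCLM ℂ (toKH (edgeMidpoint w j)))

theorem psiTilde_apply (n : ℕ) (h : C(KH, ℂ)) :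
    psiTilde n h = psi n (fun x => h (toKH x)) := by
  rw [psiTilde, StrongDual.toWeakDual_apply]
  simp [psi]

end HarmonicGasket

end

noncomputable section

namespace HarmonicGasket

/-! ### Barycentric coordinates -/

/-! Everything rests on self-similarity: both `Phi` and the normalized Hausdorff measure satisfy
functional equations under the three contractions `F j` of the gasket.

For `Phi`: the Banach fixed point theorem gives a map `Psi` with `Psi ∘ F j = H j ∘ Psi`. Its affine
functionals `affinePsi c a` are closed under composition with `F j` and obey the 2-2-1 extension
rule (`affinePsi_F_corner`), so they attain the general lower bound (3/5)^n E_0 for the energy E_n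
and are harmonic. The parallelogram identity makes harmonic functions unique, hence `Phi = Psi`
(`Phi_eq_Psi`).

The target carries the geodesic metric, so continuity of `h ∘ Phi` requires more than continuity of
`Phi` into Euclidean space. Harmonic coordinates are monotone along the edges, so edges have images
of finite length; concatenating shrinking edges joins a corner to any point by a curve of length at
most 10. As `H j` contracts lengths by 3/5, level n cells have geodesic diameter at most 20 (3/5)^n,
which gives `continuous_toKH`.

For the measure: natural covers bound the Hausdorff measure above, and a mass distribution argument
bounds it below (`hausdorffMeasure_univ_ne_top`, `hausdorffMeasure_univ_ne_zero`). Once it is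
normalizable, `hausdorffProb_eq` expresses it as the mean of its three images. Integrals and
midpoint averages then obey the same recursion, so their difference is at most the oscillation on
level n cells, which tends to 0 by uniform continuity. -/

/-- The barycentric coordinates with respect to the vertices `p`. -/
def bary (k : Fin 3) (x : E2) : ℝ :=
  ![1 - x 0 - x 1 / Real.sqrt 3, 2 * (x 1 / Real.sqrt 3), x 0 - x 1 / Real.sqrt 3] k

theorem bary_p (k j : Fin 3) : bary k (p j) = if k = j then 1 else 0 := by
  have h3 : Real.sqrt 3 ≠ 0 := by positivity
  fin_cases k <;> fin_cases j <;> simp [bary, p] <;> field_simp <;> norm_num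

theorem bary_sub_le (k : Fin 3) (x y : E2) : |bary k x - bary k y| ≤ 2 * dist x y := by
  have h0 : |x 0 - y 0| ≤ dist x y := by
    have := PiLp.norm_apply_le (x - y) 0
    rwa [← dist_eq_norm] at this
  have h1 : |x 1 - y 1| ≤ dist x y := by
    have := PiLp.norm_apply_le (x - y) 1
    rwa [← dist_eq_norm] at this
  have h3 : (1 : ℝ) ≤ Real.sqrt 3 := by
    rw [Real.one_le_sqrt]; norm_num
  have h2 : |x 1 / Real.sqrt 3 - y 1 / Real.sqrt 3| ≤ dist x y := by
    rw [← sub_div, abs_div, abs_of_pos (by positivity : 0 < Real.sqrt 3)]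
    exact (div_le_self (abs_nonneg _) h3).trans h1
  rw [abs_le] at *
  fin_cases k <;> simp [bary] <;> constructor <;> linarith [h0.1, h0.2, h2.1, h2.2]

theorem continuous_bary (k : Fin 3) : Continuous (bary k) := by
  refine (LipschitzWith.of_dist_le_mul (K := 2) fun x y => ?_).continuous
  rw [Real.dist_eq]
  exact bary_sub_le k x y

theorem bary_lineMap (k : Fin 3) (x y : E2) (t : ℝ) :
    bary k (AffineMap.lineMap x y t) = (1 - t) * bary k x + t * bary k y := by
  fin_cases k <;> simp [bary, AffineMap.lineMap_apply] <;> ring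

theorem f_eq_lineMap (j : Fin 3) (x : E2) : f j x = AffineMap.lineMap x (p j) (1 / 2 : ℝ) := by
  rw [f_apply, AffineMap.lineMap_apply_module]
  module

theorem bary_f (k j : Fin 3) (x : E2) :
    bary k (f j x) = 1 / 2 * bary k x + if k = j then 1 / 2 else 0 := by
  rw [f_eq_lineMap, bary_lineMap, bary_p]
  split_ifs <;> ring

theorem sum_bary (x : E2) : bary 0 x + bary 1 x + bary 2 x = 1 := by
  simp [bary]; ring

theorem bary_injective {x y : E2} (h : ∀ k, bary k x = bary k y) : x = y := by
  have h3 : Real.sqrt 3 ≠ 0 := by positivity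
  have h1 := h 1
  have h2 := h 2
  simp only [bary, Matrix.cons_val] at h1 h2
  have e1 : x 1 / Real.sqrt 3 = y 1 / Real.sqrt 3 := by linarith
  have e0 : x 0 = y 0 := by linarith
  ext i
  fin_cases i
  · exact e0
  · exact (div_left_inj' h3).1 e1

/-! ### The gasket as a self-similar set -/

theorem fWord_snoc {n : ℕ} (w : Fin n → Fin 3) (j : Fin 3) (x : E2) :
    fWord (n + 1) (Fin.snoc w j : Fin (n + 1) → Fin 3) x = f j (fWord n w x) := by
  simp [fWord]

theorem bary_nonneg_of_mem_T {x : E2} (hx : x ∈ T) (k : Fin 3) : 0 ≤ bary k x := by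
  obtain ⟨j, hj⟩ := mem_iUnion.1 hx
  rw [segment_eq_image_lineMap] at hj
  obtain ⟨t, ht, rfl⟩ := hj
  rw [bary_lineMap, bary_p, bary_p]
  have := ht.1
  have := ht.2
  split_ifs <;> linarith

theorem bary_fWord_nonneg {n : ℕ} (w : Fin n → Fin 3) {x : E2} (hx : x ∈ T) (k : Fin 3) :
    0 ≤ bary k (fWord n w x) := by
  induction n with
  | zero => exact bary_nonneg_of_mem_T hx k
  | succ n ih =>
    change 0 ≤ bary k (f _ (fWord n _ x))
    rw [bary_f]
    have := ih fun i => w i.castSucc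
    split_ifs <;> linarith

theorem bary_nonneg {x : E2} (hx : x ∈ SG) (k : Fin 3) : 0 ≤ bary k x := by
  have hc : IsClosed {x : E2 | 0 ≤ bary k x} := isClosed_le continuous_const (continuous_bary k)
  refine closure_minimal (iUnion_subset fun n => iUnion_subset fun w => ?_) hc hx
  rintro _ ⟨y, hy, rfl⟩
  exact bary_fWord_nonneg w hy k

theorem isCompact_SG : IsCompact SG := by
  refine Metric.isCompact_of_isClosed_isBounded isClosed_closure ?_
  refine (Metric.isBounded_iff_subset_closedBall 0).2 ⟨2, fun x hx => ?_⟩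
  have h0 := bary_nonneg hx 0
  have h1 := bary_nonneg hx 1
  have h2 := bary_nonneg hx 2
  have h3 : Real.sqrt 3 * Real.sqrt 3 = 3 := Real.mul_self_sqrt (by norm_num)
  have h3' : (0 : ℝ) < Real.sqrt 3 := by positivity
  simp only [bary, Matrix.cons_val] at h0 h1 h2
  have hx1 : x 1 = Real.sqrt 3 * (x 1 / Real.sqrt 3) := by field_simp
  rw [mem_closedBall_zero_iff, EuclideanSpace.norm_eq, Fin.sum_univ_two, Real.norm_eq_abs,
    Real.norm_eq_abs, sq_abs, sq_abs]
  refine Real.sqrt_le_iff.2 ⟨by norm_num, ?_⟩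
  set y := x 1 / Real.sqrt 3
  have hy : x 1 ^ 2 = 3 * y ^ 2 := by
    rw [hx1, mul_pow, sq (Real.sqrt 3), h3]
  rw [hy]
  nlinarith

instance : CompactSpace SG := isCompact_iff_compactSpace.1 isCompact_SG

theorem continuous_f (j : Fin 3) : Continuous (f j) := (f j).continuous_of_finiteDimensional

theorem f_mem_SG (j : Fin 3) {x : E2} (hx : x ∈ SG) : f j x ∈ SG := by
  have h : MapsTo (f j) (⋃ n, SGgraph n) (⋃ n, SGgraph n) := by
    intro x hx
    obtain ⟨n, hn⟩ := mem_iUnion.1 hx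
    obtain ⟨w, y, hy, rfl⟩ := mem_iUnion.1 hn
    exact mem_iUnion.2 ⟨n + 1, mem_iUnion.2 ⟨Fin.snoc w j, y, hy, fWord_snoc w j y⟩⟩
  exact h.closure (continuous_f j) hx

theorem exists_eq_f_of_mem_T {x : E2} (hx : x ∈ T) : ∃ j, ∃ y ∈ T, f j y = x := by
  obtain ⟨j, hj⟩ := mem_iUnion.1 hx
  rw [segment_eq_image_lineMap] at hj
  obtain ⟨t, ⟨ht0, ht1⟩, rfl⟩ := hj
  rcases le_total t (1 / 2) with h | h
  · refine ⟨j + 1, AffineMap.lineMap (p (j + 1)) (p (j + 2)) (2 * t), mem_iUnion.2 ⟨j, ?_⟩, ?_⟩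
    · rw [segment_eq_image_lineMap]
      exact mem_image_of_mem _ ⟨by linarith, by linarith⟩
    · simp only [f_eq_lineMap, AffineMap.lineMap_apply_module]
      module
  · refine ⟨j + 2, AffineMap.lineMap (p (j + 1)) (p (j + 2)) (2 * t - 1), mem_iUnion.2 ⟨j, ?_⟩, ?_⟩
    · rw [segment_eq_image_lineMap]
      exact mem_image_of_mem _ ⟨by linarith, by linarith⟩
    · simp only [f_eq_lineMap, AffineMap.lineMap_apply_module]
      module

/-- The three images form a compact, hence closed, set containing every level graph; at level 0 this
holds because halving an edge puts each half in the image of an edge. -/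
theorem exists_eq_f {x : E2} (hx : x ∈ SG) : ∃ j, ∃ y ∈ SG, f j y = x := by
  have hc : IsClosed (⋃ j, f j '' SG) :=
    isClosed_iUnion_of_finite fun j => (isCompact_SG.image (continuous_f j)).isClosed
  have hsub : (⋃ n, SGgraph n) ⊆ ⋃ j, f j '' SG := by
    refine iUnion_subset fun n => iUnion_subset fun w => ?_
    rintro _ ⟨y, hy, rfl⟩
    cases n with
    | zero =>
      obtain ⟨j, z, hz, rfl⟩ := exists_eq_f_of_mem_T hy
      exact mem_iUnion.2 ⟨j, z, fWord_mem_SG (n := 0) Fin.elim0 hz, rfl⟩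
    | succ n => exact mem_iUnion.2 ⟨w (Fin.last n), _, fWord_mem_SG _ hy, rfl⟩
  obtain ⟨j, y, hy, rfl⟩ := mem_iUnion.1 (closure_minimal hsub hc hx)
  exact ⟨j, y, hy, rfl⟩

/-- The contractions, as maps of the gasket. -/
def F (j : Fin 3) (x : SG) : SG := ⟨f j x, f_mem_SG j x.2⟩

theorem dist_F (j : Fin 3) (x y : SG) : dist (F j x) (F j y) = 1 / 2 * dist x y := by
  change dist (f j x) (f j y) = 1 / 2 * dist (x : E2) y
  rw [f_apply, f_apply, dist_add_right, dist_smul₀, dist_sub_right]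
  norm_num

theorem lipschitzWith_F (j : Fin 3) : LipschitzWith (1 / 2) (F j) :=
  LipschitzWith.of_dist_le_mul fun x y => by rw [dist_F]; simp

theorem continuous_F (j : Fin 3) : Continuous (F j) := (lipschitzWith_F j).continuous

theorem F_injective (j : Fin 3) : Function.Injective (F j) := fun x y h => by
  have := dist_F j x y
  rw [h, dist_self] at this
  exact dist_le_zero.1 (by linarith)

theorem exists_F_eq (x : SG) : ∃ j y, F j y = x := by
  obtain ⟨j, y, hy, h⟩ := exists_eq_f x.2
  exact ⟨j, ⟨y, hy⟩, Subtype.ext h⟩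

theorem bary_corner (k j : Fin 3) : bary k (corner j) = if k = j then 1 else 0 := bary_p k j

theorem eq_corner {x : SG} {j : Fin 3} (h : 1 ≤ bary j x) : x = corner j := by
  refine Subtype.ext (bary_injective fun k => ?_)
  rw [bary_corner]
  have h0 := bary_nonneg x.2 0
  have h1 := bary_nonneg x.2 1
  have h2 := bary_nonneg x.2 2
  have hs := sum_bary x
  fin_cases j <;> fin_cases k <;> simp at * <;> linarith

/-- Distinct cells touch in one vertex only: comparing i-th barycentric coordinates forces that of
`z` to be at least 1, and symmetrically for `y`. This is what makes gluing along cells possible. -/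
theorem F_eq_F {i j : Fin 3} (hij : i ≠ j) {y z : SG} (h : F i y = F j z) :
    y = corner j ∧ z = corner i := by
  have h' : f i y = f j z := congrArg Subtype.val h
  have hi := congrArg (bary i) h'
  have hj := congrArg (bary j) h'
  rw [bary_f, bary_f, if_pos rfl, if_neg hij] at hi
  rw [bary_f, bary_f, if_pos rfl, if_neg hij.symm] at hj
  have := bary_nonneg y.2 i
  have := bary_nonneg z.2 j
  exact ⟨eq_corner (by linarith), eq_corner (by linarith)⟩

theorem F_corner_comm (i j : Fin 3) : F i (corner j) = F j (corner i) := by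
  refine Subtype.ext ?_
  change f i (p j) = f j (p i)
  rw [f_apply, f_apply]
  module

theorem F_corner_self (i : Fin 3) : F i (corner i) = corner i := by
  refine Subtype.ext ?_
  change f i (p i) = p i
  rw [f_apply]
  module

/-! ### Words -/

/-- The composition of contractions along a word, as a map of the gasket. -/
def FW : (n : ℕ) → (Fin n → Fin 3) → SG → SG
  | 0, _, x => x
  | n + 1, w, x => F (w (Fin.last n)) (FW n (fun i => w i.castSucc) x)

theorem coe_FW {n : ℕ} (w : Fin n → Fin 3) (x : SG) : (FW n w x : E2) = fWord n w x := by
  induction n with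
  | zero => rfl
  | succ n ih =>
    change f _ (FW n _ x : E2) = f _ (fWord n _ x)
    rw [ih]

theorem FW_snoc {n : ℕ} (w : Fin n → Fin 3) (j : Fin 3) (x : SG) :
    FW (n + 1) (Fin.snoc w j : Fin (n + 1) → Fin 3) x = F j (FW n w x) := by
  simp [FW]

theorem vertex_eq {n : ℕ} (w : Fin n → Fin 3) (k : Fin 3) : vertex w k = FW n w (corner k) :=
  Subtype.ext (coe_FW w (corner k)).symm

/-- The midpoints of the edges of the initial triangle. -/
def baseMidpoint (j : Fin 3) : SG := edgeMidpoint (n := 0) Fin.elim0 j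

theorem edgeMidpoint_eq {n : ℕ} (w : Fin n → Fin 3) (j : Fin 3) :
    edgeMidpoint w j = FW n w (baseMidpoint j) := by
  refine Subtype.ext ?_
  rw [coe_FW]
  simp only [baseMidpoint, edgeMidpoint, AffineMap.map_midpoint, fWord, AffineMap.id_apply]

theorem dist_FW {n : ℕ} (w : Fin n → Fin 3) (x y : SG) :
    dist (FW n w x) (FW n w y) = (1 / 2) ^ n * dist x y := by
  induction n with
  | zero => simp [FW]
  | succ n ih =>
    change dist (F _ _) (F _ _) = _
    rw [dist_F, ih]; ring

theorem continuous_FW {n : ℕ} (w : Fin n → Fin 3) : Continuous (FW n w) := by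
  induction n with
  | zero => exact continuous_id
  | succ n ih => exact (continuous_F _).comp (ih _)

theorem exists_FW_eq (n : ℕ) (x : SG) : ∃ w y, FW n w y = x := by
  induction n generalizing x with
  | zero => exact ⟨Fin.elim0, x, rfl⟩
  | succ n ih =>
    obtain ⟨j, y, rfl⟩ := exists_F_eq x
    obtain ⟨w, z, rfl⟩ := ih y
    exact ⟨Fin.snoc w j, z, FW_snoc w j z⟩

/-- The diameter of the gasket. -/
def diamSG : ℝ := Metric.diam (univ : Set SG)

theorem dist_le_diamSG (x y : SG) : dist x y ≤ diamSG :=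
  Metric.dist_le_diam_of_mem isCompact_univ.isBounded (mem_univ x) (mem_univ y)

theorem tendsto_half_pow_mul (C : ℝ) : Tendsto (fun n : ℕ => (1 / 2 : ℝ) ^ n * C) atTop (𝓝 0) := by
  simpa using (tendsto_pow_atTop_nhds_zero_of_lt_one (by norm_num : (0 : ℝ) ≤ 1 / 2)
    (by norm_num)).mul_const C

theorem dense_vertices (k : Fin 3) : Dense {x : SG | ∃ n, ∃ w : Fin n → Fin 3, x = vertex w k} := by
  refine Metric.dense_iff.2 fun x r hr => ?_
  obtain ⟨n, hn⟩ := ((tendsto_half_pow_mul diamSG).eventually (gt_mem_nhds hr)).exists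
  obtain ⟨w, y, rfl⟩ := exists_FW_eq n x
  refine ⟨vertex w k, ?_, n, w, rfl⟩
  rw [Metric.mem_ball, vertex_eq, dist_FW]
  exact (mul_le_mul_of_nonneg_left (dist_le_diamSG _ _) (by positivity)).trans_lt hn

/-- The geometric bound makes the convergence uniform. Used both for curves and for the coding by
infinite words. -/
theorem exists_continuous_limit {X : Type*} [TopologicalSpace X] (g : ℕ → X → SG)
    (hg : ∀ n, Continuous (g n))
    (h : ∀ n x, dist (g n x) (g (n + 1) x) ≤ diamSG * (1 / 2) ^ n) :
    ∃ G : X → SG, Continuous G ∧ ∀ x, Tendsto (fun n => g n x) atTop (𝓝 (G x)) := by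
  have hc : ∀ x, ∃ y, Tendsto (fun n => g n x) atTop (𝓝 y) := fun x =>
    cauchySeq_tendsto_of_complete (cauchySeq_of_le_geometric _ _ (by norm_num) fun n => h n x)
  choose G hG using hc
  refine ⟨G, ?_, hG⟩
  have hu : TendstoUniformly g G atTop := by
    refine Metric.tendstoUniformly_iff.2 fun ε hε => ?_
    filter_upwards [(tendsto_half_pow_mul (diamSG * 2)).eventually (gt_mem_nhds hε)] with n hn x
    rw [dist_comm]
    refine (dist_le_of_le_geometric_of_tendsto _ _ (by norm_num) (fun n => h n x) (hG x) n).trans_lt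
      ?_
    calc _ = (1 / 2 : ℝ) ^ n * (diamSG * 2) := by ring
      _ < ε := hn
  exact hu.continuous (Frequently.of_forall hg)

/-! ### The maps `H j` -/

theorem M_eq (j : Fin 3) (v : E3) :
    M j v = (1 / 5 : ℝ) • v + (3 / 5 * inner ℝ (Pb j) v) • Pb j := by
  have h6 : (3 / Real.sqrt 6) * (3 / Real.sqrt 6) = 3 / 2 := by
    rw [div_mul_div_comm, Real.mul_self_sqrt (by norm_num)]; norm_num
  rw [M_apply, q, real_inner_smul_left, smul_smul]
  congr 2
  linear_combination (2 / 5 * inner ℝ (Pb j) v) * h6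

theorem inner_Pb (i j : Fin 3) :
    inner ℝ (Pb i) (Pb j) = if i = j then (2 / 3 : ℝ) else -1 / 3 := by
  fin_cases i <;> fin_cases j <;>
    norm_num [Pb, PiLp.inner_apply, Fin.sum_univ_three, Matrix.cons_val_two, Matrix.vecHead,
      Matrix.vecTail, -inner_self_eq_norm_sq_to_K]

theorem norm_M_le (j : Fin 3) (v : E3) : ‖M j v‖ ≤ 3 / 5 * ‖v‖ := by
  have hq : ‖q j‖ = 1 := by
    have := real_inner_self_eq_norm_sq (q j)
    rw [inner_q_self] at this
    nlinarith [norm_nonneg (q j)]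
  have hi : |inner ℝ (q j) v| ≤ ‖v‖ := by
    simpa [hq] using abs_real_inner_le_norm (q j) v
  rw [M_apply]
  refine (norm_add_le _ _).trans ?_
  rw [norm_smul, norm_smul, hq, Real.norm_eq_abs, Real.norm_eq_abs, abs_mul]
  norm_num
  linarith

/-- Self-adjointness moves `M j` onto the coefficient vector, so that the functions `affinePsi c a`
are stable under composition with `F j`. -/
theorem inner_M_left (j : Fin 3) (a v : E3) : inner ℝ a (M j v) = (inner ℝ (M j a) v : ℝ) := by
  simp only [M_apply, inner_add_left, inner_add_right, real_inner_smul_left, real_inner_smul_right]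
  rw [real_inner_comm (q j) a]
  ring

theorem H_sub (j : Fin 3) (x y : E3) : H j x - H j y = M j (x - y) := by
  simp only [H, map_sub]
  abel

theorem dist_H_le (j : Fin 3) (x y : E3) : dist (H j x) (H j y) ≤ 3 / 5 * dist x y := by
  rw [dist_eq_norm, H_sub, dist_eq_norm]
  exact norm_M_le j _

theorem lipschitzWith_H (j : Fin 3) : LipschitzWith (3 / 5) (H j) :=
  LipschitzWith.of_dist_le_mul fun x y => by simpa using dist_H_le j x y

theorem H_cornerH_self (j : Fin 3) : H j (cornerH j) = cornerH j := by simp [H]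

/-- The symmetry in `i` and `j` is the matching condition at the vertex shared by two cells. As the
corners sum to zero, the value is also the harmonic mean with weights 2/5, 2/5, 1/5. -/
theorem H_cornerH {i j : Fin 3} (hij : i ≠ j) :
    H i (cornerH j) = (1 / 5 : ℝ) • (cornerH i + cornerH j) := by
  rw [H, M_eq]
  simp only [cornerH, inner_sub_right, real_inner_smul_right, inner_Pb, if_neg hij, if_true]
  module

theorem cornerH_mem_Z (j : Fin 3) : cornerH j ∈ Z := Z.smul_mem _ (Pb_mem_Z j)

theorem H_mem_Z (j : Fin 3) {v : E3} (hv : v ∈ Z) : H j v ∈ Z :=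
  Z.add_mem (M_mem_Z j (Z.sub_mem hv (cornerH_mem_Z j))) (cornerH_mem_Z j)

theorem isClosed_Z : IsClosed (Z : Set E3) := Z.closed_of_finiteDimensional

theorem cornerH_apply (j k : Fin 3) :
    cornerH j k = 1 / Real.sqrt 2 * if j = k then 2 / 3 else -1 / 3 := by
  fin_cases j <;> fin_cases k <;> simp [cornerH, Pb]

/-! ### The solution of the functional equation -/

/-- Continuous maps into the plane `Z` that send corners to corners. -/
def CornerMaps : Set C(SG, E3) := {g | (∀ k, g (corner k) = cornerH k) ∧ ∀ x, g x ∈ Z}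

theorem isClosed_CornerMaps : IsClosed CornerMaps := by
  have : CornerMaps = (⋂ k, {g : C(SG, E3) | g (corner k) = cornerH k}) ∩
      ⋂ x, {g : C(SG, E3) | g x ∈ (Z : Set E3)} := by
    ext g; simp [CornerMaps]
  rw [this]
  refine (isClosed_iInter fun k => ?_).inter (isClosed_iInter fun x => ?_)
  · exact isClosed_eq (continuous_eval_const _) continuous_const
  · exact isClosed_Z.preimage (continuous_eval_const x)

/-- The map from `Fin 3 × SG` onto the gasket is a closed continuous surjection, hence a quotient
map. -/
theorem continuous_of_comp_F {Y : Type*} [TopologicalSpace Y] {g : SG → Y}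
    (h : ∀ j, Continuous fun x => g (F j x)) : Continuous g := by
  let π : Fin 3 × SG → SG := fun a => F a.1 a.2
  have hπ : Continuous π := continuous_prod_of_discrete_left.2 continuous_F
  have hs : Function.Surjective π := fun x => by
    obtain ⟨j, y, h⟩ := exists_F_eq x
    exact ⟨(j, y), h⟩
  refine (hπ.isClosedMap.isQuotientMap hπ hs).continuous_iff.2 ?_
  exact continuous_prod_of_discrete_left.2 h

theorem exists_cornerMap_step (g : CornerMaps) :
    ∃ g' : CornerMaps, ∀ j x, g'.1 (F j x) = H j (g.1 x) := by
  obtain ⟨g, hg, hgZ⟩ := g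
  -- The glued value does not depend on the chosen cell: two cells share only a vertex, where
  -- `H_cornerH` is symmetric.
  have hw : ∀ i j y z, F i y = F j z → H i (g y) = H j (g z) := by
    intro i j y z h
    by_cases hij : i = j
    · subst hij
      rw [F_injective i h]
    · obtain ⟨rfl, rfl⟩ := F_eq_F hij h
      rw [hg, hg, H_cornerH hij, H_cornerH (Ne.symm hij), add_comm]
  choose idx pre hpre using exists_F_eq
  have hcomp : ∀ j x, H (idx (F j x)) (g (pre (F j x))) = H j (g x) := fun j x =>
    hw _ _ _ _ (hpre _)
  refine ⟨⟨⟨fun x => H (idx x) (g (pre x)), continuous_of_comp_F fun j => ?_⟩, ?_, ?_⟩, hcomp⟩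
  · simp only [hcomp]
    exact (lipschitzWith_H j).continuous.comp g.continuous
  · intro k
    have := hcomp k (corner k)
    rw [F_corner_self, hg, H_cornerH_self] at this
    exact this
  · exact fun x => H_mem_Z _ (hgZ _)

theorem exists_cornerMap_fixed : ∃ g : CornerMaps, ∀ j x, g.1 (F j x) = H j (g.1 x) := by
  choose S hS using exists_cornerMap_step
  have hne : Nonempty CornerMaps := by
    -- Barycentric interpolation of the corners serves as a starting point.
    refine ⟨⟨⟨fun x => ∑ k, bary k x • cornerH k, ?_⟩, fun k => ?_, fun x => ?_⟩⟩
    · exact continuous_finsetSum _ fun k _ =>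
        ((continuous_bary k).comp continuous_subtype_val).smul continuous_const
    · simp [bary_corner]
    · exact Z.sum_mem (t := Finset.univ) fun k _ => Z.smul_mem (bary k x) (cornerH_mem_Z k)
  have : CompleteSpace CornerMaps := isClosed_CornerMaps.completeSpace_coe
  have hc : ContractingWith (3 / 5) S := by
    refine ⟨by rw [← NNReal.coe_lt_coe]; norm_num, LipschitzWith.of_dist_le_mul fun g g' => ?_⟩
    rw [Subtype.dist_eq, ContinuousMap.dist_le (by positivity)]
    intro x
    obtain ⟨j, y, rfl⟩ := exists_F_eq x
    rw [hS, hS]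
    refine (dist_H_le j _ _).trans ?_
    have := ContinuousMap.dist_apply_le_dist (f := g.1) (g := g'.1) y
    rw [Subtype.dist_eq]
    simpa using this
  refine ⟨hc.fixedPoint S, fun j x => ?_⟩
  have := hS (hc.fixedPoint S) j x
  rwa [hc.fixedPoint_isFixedPt] at this

/-- The solution `Psi` of `Psi ∘ F j = H j ∘ Psi`. -/
def Psi : C(SG, E3) := exists_cornerMap_fixed.choose.1

theorem Psi_corner (k : Fin 3) : Psi (corner k) = cornerH k :=
  exists_cornerMap_fixed.choose.2.1 k

theorem Psi_mem_Z (x : SG) : Psi x ∈ Z := exists_cornerMap_fixed.choose.2.2 x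

theorem Psi_F (j : Fin 3) (x : SG) : Psi (F j x) = H j (Psi x) :=
  exists_cornerMap_fixed.choose_spec j x

/-! ### Energies -/

theorem energy_zero (u : SG → ℝ) :
    energy 0 u = ∑ j : Fin 3, (u (corner (j + 1)) - u (corner (j + 2))) ^ 2 := by
  simp only [energy, vertex_eq, FW]
  simp

theorem energy_succ (n : ℕ) (u : SG → ℝ) :
    energy (n + 1) u = ∑ j, energy n fun x => u (F j x) := by
  simp only [energy, vertex_eq]
  rw [← (Fin.snocEquiv fun _ : Fin (n + 1) => Fin 3).sum_comp, Fintype.sum_prod_type]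
  refine Finset.sum_congr rfl fun j _ => Finset.sum_congr rfl fun w _ => ?_
  have h : (Fin.snocEquiv fun _ : Fin (n + 1) => Fin 3) (j, w) = Fin.snoc w j := rfl
  simp only [h, FW_snoc]

/-- The best extension of corner values a, b, c takes the value (2a + 2b + c)/5 between a and b, and
so on. The excess energy is the quadratic form in the three deviations: twice their squares plus the
squares of their differences. -/
theorem energy_zero_le_energy_one (v : SG → ℝ) : 3 / 5 * energy 0 v ≤ energy 1 v := by
  rw [energy_succ]
  simp only [energy_zero, Fin.sum_univ_three, Fin.isValue, Fin.reduceAdd, F_corner_self]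
  rw [F_corner_comm 1 0, F_corner_comm 2 0, F_corner_comm 2 1]
  generalize v (corner 0) = a
  generalize v (corner 1) = b
  generalize v (corner 2) = c
  generalize v (F 0 (corner 1)) = x
  generalize v (F 0 (corner 2)) = y
  generalize v (F 1 (corner 2)) = z
  nlinarith [sq_nonneg (x - (2 * a + 2 * b + c) / 5), sq_nonneg (y - (2 * a + 2 * c + b) / 5),
    sq_nonneg (z - (2 * b + 2 * c + a) / 5),
    sq_nonneg (x - (2 * a + 2 * b + c) / 5 - (y - (2 * a + 2 * c + b) / 5)),
    sq_nonneg (x - (2 * a + 2 * b + c) / 5 - (z - (2 * b + 2 * c + a) / 5)),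
    sq_nonneg (y - (2 * a + 2 * c + b) / 5 - (z - (2 * b + 2 * c + a) / 5))]

theorem energy_lower_bound (n : ℕ) (v : SG → ℝ) : (3 / 5) ^ n * energy 0 v ≤ energy n v := by
  induction n generalizing v with
  | zero => simp
  | succ n ih =>
    calc (3 / 5) ^ (n + 1) * energy 0 v = (3 / 5) ^ n * (3 / 5 * energy 0 v) := by ring
      _ ≤ (3 / 5) ^ n * energy 1 v :=
        mul_le_mul_of_nonneg_left (energy_zero_le_energy_one v) (by positivity)
      _ = ∑ j, (3 / 5) ^ n * energy 0 fun x => v (F j x) := by rw [energy_succ, Finset.mul_sum]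
      _ ≤ ∑ j, energy n fun x => v (F j x) := Finset.sum_le_sum fun j _ => ih _
      _ = energy (n + 1) v := (energy_succ n v).symm

theorem energy_parallelogram (n : ℕ) (u v : SG → ℝ) :
    energy n (u + v) + energy n (u - v) = 2 * energy n u + 2 * energy n v := by
  simp only [energy, Finset.mul_sum, ← Finset.sum_add_distrib, Pi.add_apply, Pi.sub_apply]
  refine Finset.sum_congr rfl fun w _ => Finset.sum_congr rfl fun j _ => ?_
  ring

theorem energy_nonneg (n : ℕ) (u : SG → ℝ) : 0 ≤ energy n u :=
  Finset.sum_nonneg fun _ _ => Finset.sum_nonneg fun _ _ => sq_nonneg _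

/-- Zero energy means constancy along edges, and the level n graph is connected. -/
theorem eq_of_energy_eq_zero {n : ℕ} {u : SG → ℝ} (h : energy n u = 0) (w : Fin n → Fin 3)
    (k : Fin 3) : u (vertex w k) = u (corner 0) := by
  rw [vertex_eq]
  induction n generalizing u k with
  | zero =>
    change u (corner k) = _
    simp only [energy_zero, Fin.sum_univ_three, Fin.isValue, Fin.reduceAdd] at h
    have h1 : (u (corner 2) - u (corner 0)) ^ 2 = 0 := by
      nlinarith [sq_nonneg (u (corner 1) - u (corner 2)), sq_nonneg (u (corner 2) - u (corner 0)),
        sq_nonneg (u (corner 0) - u (corner 1))]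
    have h2 : (u (corner 0) - u (corner 1)) ^ 2 = 0 := by
      nlinarith [sq_nonneg (u (corner 1) - u (corner 2)), sq_nonneg (u (corner 2) - u (corner 0)),
        sq_nonneg (u (corner 0) - u (corner 1))]
    have h1 := pow_eq_zero_iff (two_ne_zero) |>.1 h1
    have h2 := pow_eq_zero_iff (two_ne_zero) |>.1 h2
    fin_cases k <;> simp <;> linarith
  | succ n ih =>
    rw [energy_succ, Finset.sum_eq_zero_iff_of_nonneg fun _ _ => energy_nonneg _ _] at h
    have h' : ∀ j (w : Fin n → Fin 3) k, u (F j (FW n w (corner k))) = u (F j (corner 0)) :=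
      fun j => ih (h j (Finset.mem_univ j))
    have hfix : ∀ n k, FW n (fun _ => k) (corner k) = corner k := by
      intro n k
      induction n with
      | zero => rfl
      | succ n ih =>
        change F k (FW n (fun _ => k) (corner k)) = _
        rw [ih, F_corner_self]
    -- Cell 0 and the cell of the last letter l share the vertex `F 0 (corner l) = F l (corner 0)`;
    -- the constant word l reaches `corner l`, which links the two constants.
    have h0 := h' 0 (fun _ => w (Fin.last n)) (w (Fin.last n))
    rw [hfix, F_corner_comm, F_corner_self] at h0
    exact (h' _ _ _).trans h0

/-! ### Harmonic functions -/

/-- The functions `c + ⟪a, Psi⟫`. -/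
def affinePsi (c : ℝ) (a : E3) (x : SG) : ℝ := c + inner ℝ a (Psi x)

theorem continuous_affinePsi (c : ℝ) (a : E3) : Continuous (affinePsi c a) :=
  continuous_const.add (continuous_const.inner Psi.continuous)

theorem affinePsi_F (c : ℝ) (a : E3) (j : Fin 3) (x : SG) :
    affinePsi c a (F j x) =
      affinePsi (c + inner ℝ a (cornerH j) - inner ℝ (M j a) (cornerH j)) (M j a) x := by
  simp only [affinePsi, Psi_F, H, inner_add_right, inner_M_left, inner_sub_right]
  ring

theorem sum_cornerH : cornerH 0 + cornerH 1 + cornerH 2 = 0 := by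
  ext i
  simp only [PiLp.add_apply, cornerH_apply]
  fin_cases i <;> simp <;> ring

theorem affinePsi_F_corner (c : ℝ) (a : E3) {i j k : Fin 3} (hij : i ≠ j) (hik : i ≠ k)
    (hjk : j ≠ k) :
    affinePsi c a (F i (corner j)) = (2 * affinePsi c a (corner i) + 2 * affinePsi c a (corner j) +
      affinePsi c a (corner k)) / 5 := by
  have hs : cornerH i + cornerH j + cornerH k = 0 := by
    rw [← sum_cornerH]
    fin_cases i <;> fin_cases j <;> fin_cases k <;> simp at * <;> abel
  have hs := congrArg (fun v => (inner ℝ a v : ℝ)) hs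
  simp only [inner_add_right, inner_zero_right] at hs
  simp only [affinePsi, Psi_F, Psi_corner, H_cornerH hij, inner_add_right, real_inner_smul_right]
  linarith

theorem energy_one_affinePsi (c : ℝ) (a : E3) :
    energy 1 (affinePsi c a) = 3 / 5 * energy 0 (affinePsi c a) := by
  rw [energy_succ]
  simp only [energy_zero, Fin.sum_univ_three, Fin.isValue, Fin.reduceAdd, F_corner_self]
  rw [F_corner_comm 1 0, F_corner_comm 2 0, F_corner_comm 2 1,
    affinePsi_F_corner c a (i := 0) (j := 1) (k := 2) (by decide) (by decide) (by decide),
    affinePsi_F_corner c a (i := 0) (j := 2) (k := 1) (by decide) (by decide) (by decide),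
    affinePsi_F_corner c a (i := 1) (j := 2) (k := 0) (by decide) (by decide) (by decide)]
  ring

theorem energy_affinePsi (n : ℕ) (c : ℝ) (a : E3) :
    energy n (affinePsi c a) = (3 / 5) ^ n * energy 0 (affinePsi c a) := by
  induction n generalizing c a with
  | zero => simp
  | succ n ih =>
    rw [energy_succ]
    simp only [affinePsi_F, ih]
    rw [← Finset.mul_sum, pow_succ, mul_assoc, ← energy_one_affinePsi, energy_succ]
    simp only [affinePsi_F]

theorem isHarmonic_affinePsi (c : ℝ) (a : E3) : IsHarmonic (affinePsi c a) := by
  refine ⟨continuous_affinePsi c a, fun n v hv => ?_⟩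
  rw [energy_affinePsi]
  refine le_trans (le_of_eq ?_) (energy_lower_bound n v)
  simp only [energy_zero, hv]

/-- Minimality gives E(u) ≤ E(v), while u + v has the corner values of 2v and hence energy at least
4 E(v). The parallelogram identity leaves E(u - v) ≤ 0 at every level, and vertices are dense. -/
theorem IsHarmonic.eq_affinePsi {u : SG → ℝ} (hu : IsHarmonic u) {c : ℝ} {a : E3}
    (h : ∀ k, u (corner k) = affinePsi c a (corner k)) : u = affinePsi c a := by
  set v := affinePsi c a
  have hz : ∀ n, energy n (u - v) = 0 := fun n => by
    have h1 := energy_parallelogram n u v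
    have h2 : energy n u ≤ energy n v := hu.2 n v fun k => (h k).symm
    have h3 := energy_lower_bound n (u + v)
    have h4 : energy 0 (u + v) = 4 * energy 0 v := by
      simp only [energy_zero, Pi.add_apply, h, Finset.mul_sum]
      exact Finset.sum_congr rfl fun _ _ => by ring
    have h5 : energy n v = (3 / 5) ^ n * energy 0 v := energy_affinePsi n c a
    rw [h4] at h3
    exact le_antisymm (by linarith) (energy_nonneg _ _)
  refine hu.1.ext_on (dense_vertices 0) (continuous_affinePsi c a) ?_
  rintro x ⟨n, w, rfl⟩
  have := eq_of_energy_eq_zero (hz n) w 0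
  simp only [Pi.sub_apply, h, sub_self] at this
  exact sub_eq_zero.1 this

theorem harmonicBasis_eq (j : Fin 3) :
    harmonicBasis j = affinePsi (1 / 3) (Real.sqrt 2 • EuclideanSpace.single j 1) := by
  have h2 : Real.sqrt 2 ≠ 0 := by positivity
  have hc : ∀ k, affinePsi (1 / 3) (Real.sqrt 2 • EuclideanSpace.single j 1) (corner k) =
      if k = j then 1 else 0 := fun k => by
    simp only [affinePsi, Psi_corner, real_inner_smul_left, EuclideanSpace.inner_single_left,
      cornerH_apply]
    split_ifs <;> simp <;> field_simp <;> norm_num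
  have hs := Classical.epsilon_spec (p := fun u : SG → ℝ =>
    IsHarmonic u ∧ ∀ k, u (corner k) = if k = j then 1 else 0) ⟨_, isHarmonic_affinePsi _ _, hc⟩
  exact hs.1.eq_affinePsi fun k => (hs.2 k).trans (hc k).symm

theorem Phi_eq_Psi : Phi = Psi := by
  have h2 : Real.sqrt 2 ≠ 0 := by positivity
  funext x
  ext i
  simp only [Phi, harmonicBasis_eq, affinePsi, real_inner_smul_left,
    EuclideanSpace.inner_single_left]
  fin_cases i <;> simp [h2]

/-! ### The maximum principle -/

theorem affinePsi_F_corner_le {c : ℝ} {a : E3} {m : ℝ} (h : ∀ k, affinePsi c a (corner k) ≤ m)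
    (i j : Fin 3) : affinePsi c a (F i (corner j)) ≤ m := by
  by_cases hij : i = j
  · rw [hij, F_corner_self]
    exact h j
  · obtain ⟨k, hik, hjk⟩ : ∃ k, i ≠ k ∧ j ≠ k := by
      revert i j; decide
    rw [affinePsi_F_corner c a hij hik hjk]
    linarith [h i, h j, h k]

/-- Corner values on subcells are convex combinations of those on the parent cell; density of the
vertices does the rest. -/
theorem affinePsi_le {c : ℝ} {a : E3} {m : ℝ} (h : ∀ k, affinePsi c a (corner k) ≤ m) (x : SG) :
    affinePsi c a x ≤ m := by
  have hv : ∀ (n : ℕ) (w : Fin n → Fin 3) k, affinePsi c a (FW n w (corner k)) ≤ m := by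
    intro n
    induction n generalizing c a with
    | zero => exact fun w k => h k
    | succ n ih =>
      intro w k
      change affinePsi c a (F _ (FW n _ _)) ≤ m
      rw [affinePsi_F]
      refine ih (fun l => ?_) _ k
      rw [← affinePsi_F]
      exact affinePsi_F_corner_le h _ l
  have hcl : IsClosed {x | affinePsi c a x ≤ m} :=
    isClosed_le (continuous_affinePsi c a) continuous_const
  refine hcl.closure_subset_iff.2 ?_ (dense_vertices 0 x)
  rintro _ ⟨n, w, rfl⟩
  rw [vertex_eq]
  exact hv n w 0

theorem le_affinePsi {c : ℝ} {a : E3} {m : ℝ} (h : ∀ k, m ≤ affinePsi c a (corner k)) (x : SG) :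
    m ≤ affinePsi c a x := by
  have hn : ∀ y, affinePsi (-c) (-a) y = -affinePsi c a y := fun y => by
    simp only [affinePsi, inner_neg_left]; ring
  have := affinePsi_le (c := -c) (a := -a) (m := -m) (fun k => by rw [hn]; linarith [h k]) x
  rw [hn] at this
  linarith

theorem forall_of_distinct {i j k : Fin 3} (hij : i ≠ j) (hik : i ≠ k) (hjk : j ≠ k)
    {P : Fin 3 → Prop} (hi : P i) (hj : P j) (hk : P k) (l : Fin 3) : P l := by
  have : l = i ∨ l = j ∨ l = k := by
    clear hi hj hk
    revert i j k l; decide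
  rcases this with rfl | rfl | rfl <;> assumption

/-! ### Edges -/

theorem segment_subset_T (i j : Fin 3) : segment ℝ (p i) (p j) ⊆ T := by
  have h : ∀ i j : Fin 3, i = j ∨ (∃ k : Fin 3, i = k + 1 ∧ j = k + 2) ∨
      ∃ k : Fin 3, j = k + 1 ∧ i = k + 2 := by decide
  rcases h i j with rfl | ⟨k, rfl, rfl⟩ | ⟨k, rfl, rfl⟩
  · rw [segment_same, singleton_subset_iff]
    exact p_mem_T i
  · exact subset_iUnion (fun k : Fin 3 => segment ℝ (p (k + 1)) (p (k + 2))) k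
  · rw [segment_symm]
    exact subset_iUnion (fun k : Fin 3 => segment ℝ (p (k + 1)) (p (k + 2))) k

/-- The parametrization of the edge from `corner i` to `corner j` by `[0, 1]`, extended by
constants. -/
def edgePt (i j : Fin 3) (t : ℝ) : SG :=
  ⟨AffineMap.lineMap (p i) (p j) (projIcc (0 : ℝ) 1 zero_le_one t : ℝ),
    fWord_mem_SG (n := 0) Fin.elim0 (segment_subset_T i j (by
      rw [segment_eq_image_lineMap]
      exact mem_image_of_mem _ (projIcc (0 : ℝ) 1 zero_le_one t).2))⟩

theorem coe_edgePt (i j : Fin 3) {t : ℝ} (ht : t ∈ Icc (0 : ℝ) 1) :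
    (edgePt i j t : E2) = AffineMap.lineMap (p i) (p j) t := by
  simp only [edgePt, projIcc_of_mem zero_le_one ht]

theorem continuous_edgePt (i j : Fin 3) : Continuous (edgePt i j) := by
  refine Continuous.subtype_mk ?_ _
  exact AffineMap.lineMap_continuous.comp (continuous_subtype_val.comp continuous_projIcc)

theorem edgePt_of_nonpos (i j : Fin 3) {t : ℝ} (ht : t ≤ 0) : edgePt i j t = corner i := by
  refine Subtype.ext ?_
  simp [edgePt, projIcc_of_le_left _ ht, coe_corner]

theorem edgePt_one (i j : Fin 3) : edgePt i j 1 = corner j := by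
  refine Subtype.ext ?_
  rw [coe_edgePt i j (by simp), AffineMap.lineMap_apply_one, coe_corner]

theorem edgePt_first_half (i j : Fin 3) {t : ℝ} (ht : t ∈ Icc (0 : ℝ) (1 / 2)) :
    edgePt i j t = F i (edgePt i j (2 * t)) := by
  have h1 := ht.1
  have h2 := ht.2
  refine Subtype.ext ?_
  change _ = f i (edgePt i j (2 * t))
  rw [coe_edgePt i j ⟨h1, by linarith⟩, coe_edgePt i j ⟨by linarith, by linarith⟩, f_apply]
  simp only [AffineMap.lineMap_apply_module]
  module

theorem edgePt_second_half (i j : Fin 3) {t : ℝ} (ht : t ∈ Icc (1 / 2 : ℝ) 1) :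
    edgePt i j t = F j (edgePt i j (2 * t - 1)) := by
  have h1 := ht.1
  have h2 := ht.2
  refine Subtype.ext ?_
  change _ = f j (edgePt i j (2 * t - 1))
  rw [coe_edgePt i j ⟨by linarith, h2⟩, coe_edgePt i j ⟨by linarith, by linarith⟩, f_apply]
  simp only [AffineMap.lineMap_apply_module]
  module

/-- If the third corner has an intermediate value, the same ordering recurs on both half edges, with
the total drop reduced by at least the factor 3/5. Letting n grow shows that the function does not
increase along the edge. -/
theorem affinePsi_edgePt_sub_le {i j k : Fin 3} (hij : i ≠ j) (hik : i ≠ k) (hjk : j ≠ k) (n : ℕ)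
    {c : ℝ} {a : E3} (h1 : affinePsi c a (corner j) ≤ affinePsi c a (corner k))
    (h2 : affinePsi c a (corner k) ≤ affinePsi c a (corner i))
    {s t : ℝ} (hs : 0 ≤ s) (hst : s ≤ t) (ht : t ≤ 1) :
    affinePsi c a (edgePt i j t) - affinePsi c a (edgePt i j s) ≤
      (3 / 5) ^ n * (affinePsi c a (corner i) - affinePsi c a (corner j)) := by
  induction n generalizing c a s t with
  | zero =>
    have hle : ∀ x, affinePsi c a x ≤ affinePsi c a (corner i) :=
      affinePsi_le (forall_of_distinct hij hik hjk le_rfl (h1.trans h2) h2)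
    have hge : ∀ x, affinePsi c a (corner j) ≤ affinePsi c a x :=
      le_affinePsi (forall_of_distinct hij hik hjk (h1.trans h2) le_rfl h1)
    rw [pow_zero, one_mul]
    exact sub_le_sub (hle _) (hge _)
  | succ n ih =>
    have hpos : (0 : ℝ) ≤ (3 / 5) ^ n := by positivity
    have eij := affinePsi_F_corner c a hij hik hjk
    have eik := affinePsi_F_corner c a hik hij hjk.symm
    have ejk := affinePsi_F_corner c a hjk hij.symm hik.symm
    have eji := affinePsi_F_corner c a hij.symm hjk hik
    have eii := congrArg (affinePsi c a) (F_corner_self i)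
    have ejj := congrArg (affinePsi c a) (F_corner_self j)
    rw [affinePsi_F] at eij eik ejk eji eii ejj
    rcases le_total t (1 / 2) with ht2 | ht2
    · rw [edgePt_first_half i j ⟨hs.trans hst, ht2⟩, edgePt_first_half i j ⟨hs, hst.trans ht2⟩,
        affinePsi_F, affinePsi_F]
      refine (ih (by linarith) (by linarith) (by linarith) (by linarith) (by linarith)).trans ?_
      rw [pow_succ, mul_assoc]
      exact mul_le_mul_of_nonneg_left (by linarith) hpos
    rcases le_total s (1 / 2) with hs2 | hs2
    · rw [edgePt_second_half i j ⟨ht2, ht⟩, edgePt_first_half i j ⟨hs, hs2⟩,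
        affinePsi_F, affinePsi_F]
      -- For points in different halves, the value at the edge midpoint separates the cells: it is
      -- the maximum on cell `j` and the minimum on cell `i`.
      have u1 := affinePsi_le (forall_of_distinct hij hik hjk eji.le
        (ejj.le.trans (by linarith)) (ejk.le.trans (by linarith))) (edgePt i j (2 * t - 1))
      have u2 := le_affinePsi (forall_of_distinct hij hik hjk
        (le_trans (by linarith) eii.ge) eij.ge (le_trans (by linarith) eik.ge)) (edgePt i j (2 * s))
      have : 0 ≤ (3 / 5 : ℝ) ^ (n + 1) * (affinePsi c a (corner i) - affinePsi c a (corner j)) :=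
        mul_nonneg (by positivity) (by linarith)
      linarith
    · rw [edgePt_second_half i j ⟨ht2, ht⟩, edgePt_second_half i j ⟨hs2, hst.trans ht⟩,
        affinePsi_F, affinePsi_F]
      refine (ih (by linarith) (by linarith) (by linarith) (by linarith) (by linarith)).trans ?_
      rw [pow_succ, mul_assoc]
      exact mul_le_mul_of_nonneg_left (by linarith) hpos

theorem affinePsi_edgePt_antitone {i j k : Fin 3} (hij : i ≠ j) (hik : i ≠ k) (hjk : j ≠ k)
    {c : ℝ} {a : E3} (h1 : affinePsi c a (corner j) ≤ affinePsi c a (corner k))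
    (h2 : affinePsi c a (corner k) ≤ affinePsi c a (corner i)) {s t : ℝ} (hs : 0 ≤ s)
    (hst : s ≤ t) (ht : t ≤ 1) :
    affinePsi c a (edgePt i j t) ≤ affinePsi c a (edgePt i j s) := by
  have hlim := (tendsto_pow_atTop_nhds_zero_of_lt_one (by norm_num : (0 : ℝ) ≤ 3 / 5)
    (by norm_num)).mul_const (affinePsi c a (corner i) - affinePsi c a (corner j))
  rw [zero_mul] at hlim
  exact sub_nonpos.1 (ge_of_tendsto' hlim fun n =>
    affinePsi_edgePt_sub_le hij hik hjk n h1 h2 hs hst ht)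

theorem norm_le_of_mem_Z {i j : Fin 3} (hij : i ≠ j) {z : E3} (hz : z ∈ Z) :
    ‖z‖ ≤ 2 * (|z i| + |z j|) := by
  have hz : z 0 + z 1 + z 2 = 0 := hz
  rw [EuclideanSpace.norm_eq, Fin.sum_univ_three]
  refine Real.sqrt_le_iff.2 ⟨by positivity, ?_⟩
  simp only [Real.norm_eq_abs, sq_abs]
  have h : ∀ x y : ℝ, x ^ 2 + y ^ 2 + (x + y) ^ 2 ≤ (2 * (|x| + |y|)) ^ 2 := fun x y => by
    have := abs_mul_abs_self x
    have := abs_mul_abs_self y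
    have := mul_nonneg (abs_nonneg x) (abs_nonneg y)
    nlinarith [sq_nonneg (x - y)]
  have h0 : z 0 = -(z 1 + z 2) := by linarith
  have h1 : z 1 = -(z 0 + z 2) := by linarith
  have h2 : z 2 = -(z 0 + z 1) := by linarith
  have e01 := h (z 0) (z 1)
  have e12 := h (z 1) (z 2)
  have e02 := h (z 0) (z 2)
  have s0 : z 0 ^ 2 = (z 1 + z 2) ^ 2 := by rw [h0, neg_sq]
  have s1 : z 1 ^ 2 = (z 0 + z 2) ^ 2 := by rw [h1, neg_sq]
  have s2 : z 2 ^ 2 = (z 0 + z 1) ^ 2 := by rw [h2, neg_sq]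
  fin_cases i <;> fin_cases j <;> simp at hij ⊢ <;> linarith

theorem eVariationOn_le_of_dist_le {γ : ℝ → E3} {φ : ℝ → ℝ} {a b : ℝ} (hab : a ≤ b)
    (h : ∀ s ∈ Icc a b, ∀ t ∈ Icc a b, s ≤ t → dist (γ t) (γ s) ≤ φ t - φ s) :
    eVariationOn γ (Icc a b) ≤ ENNReal.ofReal (φ b - φ a) := by
  refine iSup_le ?_
  rintro ⟨n, u, hu, hus⟩
  have hφ : ∀ s ∈ Icc a b, ∀ t ∈ Icc a b, s ≤ t → φ s ≤ φ t := fun s hs t ht hst =>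
    sub_nonneg.1 (dist_nonneg.trans (h s hs t ht hst))
  calc ∑ i ∈ Finset.range n, edist (γ (u (i + 1))) (γ (u i))
      ≤ ∑ i ∈ Finset.range n, ENNReal.ofReal (φ (u (i + 1)) - φ (u i)) :=
        Finset.sum_le_sum fun i _ => by
          rw [edist_dist]
          exact ENNReal.ofReal_le_ofReal (h _ (hus i) _ (hus (i + 1)) (hu (Nat.le_succ i)))
    _ = ENNReal.ofReal (∑ i ∈ Finset.range n, (φ (u (i + 1)) - φ (u i))) :=
        (ENNReal.ofReal_sum_of_nonneg fun i _ =>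
          sub_nonneg.2 (hφ _ (hus i) _ (hus (i + 1)) (hu (Nat.le_succ i)))).symm
    _ ≤ ENNReal.ofReal (φ b - φ a) := by
        rw [Finset.sum_range_sub fun i => φ (u i)]
        have h1 := hφ _ (hus n) b ⟨hab, le_rfl⟩ (hus n).2
        have h2 := hφ a ⟨le_rfl, hab⟩ _ (hus 0) (hus 0).1
        exact ENNReal.ofReal_le_ofReal (by linarith)

/-- Along the edge the i-th coordinate decreases and the j-th increases; on `Z` these two control
the norm. The length is therefore at most 4/√2. -/
theorem eVariationOn_Psi_edgePt_le (i j : Fin 3) :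
    eVariationOn (fun t => Psi (edgePt i j t)) (Icc 0 1) ≤ 4 := by
  rcases eq_or_ne i j with hij | hij
  · subst hij
    have hc : ∀ t, edgePt i i t = corner i := fun t =>
      Subtype.ext (by simp [edgePt, coe_corner])
    have h0 : eVariationOn (fun t => Psi (edgePt i i t)) (Icc 0 1) = 0 := by
      refine eVariationOn.constant_on ?_
      rintro _ ⟨s, -, rfl⟩ _ ⟨t, -, rfl⟩
      simp only [hc]
    rw [h0]
    exact zero_le
  obtain ⟨k, hik, hjk⟩ : ∃ k, i ≠ k ∧ j ≠ k := by
    revert i j; decide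
  have hco : ∀ l x, affinePsi 0 (EuclideanSpace.single l 1) x = Psi x l := fun l x => by
    simp [affinePsi, EuclideanSpace.inner_single_left]
  have hco' : ∀ l x, affinePsi 0 (-EuclideanSpace.single l 1) x = -Psi x l := fun l x => by
    simp [affinePsi, EuclideanSpace.inner_single_left]
  have h2 : (0 : ℝ) < 1 / Real.sqrt 2 := by positivity
  have hi : ∀ s ∈ Icc (0 : ℝ) 1, ∀ t ∈ Icc (0 : ℝ) 1, s ≤ t →
      Psi (edgePt i j t) i ≤ Psi (edgePt i j s) i := fun s hs t ht hst => by
    rw [← hco, ← hco]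
    refine affinePsi_edgePt_antitone hij hik hjk ?_ ?_ hs.1 hst ht.2 <;>
      simp only [hco, Psi_corner, cornerH_apply, if_neg hij.symm, if_neg hik.symm, if_true] <;>
      nlinarith
  have hj : ∀ s ∈ Icc (0 : ℝ) 1, ∀ t ∈ Icc (0 : ℝ) 1, s ≤ t →
      Psi (edgePt i j s) j ≤ Psi (edgePt i j t) j := fun s hs t ht hst => by
    rw [← neg_le_neg_iff, ← hco', ← hco']
    refine affinePsi_edgePt_antitone hij hik hjk ?_ ?_ hs.1 hst ht.2 <;>
      simp only [hco', Psi_corner, cornerH_apply, if_neg hij, if_neg hjk.symm, if_true] <;>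
      nlinarith
  refine (eVariationOn_le_of_dist_le (φ := fun t => 2 * (Psi (edgePt i j t) j -
    Psi (edgePt i j t) i)) zero_le_one fun s hs t ht hst => ?_).trans ?_
  · rw [dist_eq_norm]
    refine (norm_le_of_mem_Z hij (Z.sub_mem (Psi_mem_Z _) (Psi_mem_Z _))).trans ?_
    rw [PiLp.sub_apply, PiLp.sub_apply, abs_of_nonpos (sub_nonpos.2 (hi s hs t ht hst)),
      abs_of_nonneg (sub_nonneg.2 (hj s hs t ht hst))]
    linarith
  · have hle : 1 / Real.sqrt 2 ≤ 1 := by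
      rw [div_le_one (by positivity), Real.one_le_sqrt]
      norm_num
    rw [show (4 : ℝ≥0∞) = ENNReal.ofReal 4 by simp]
    refine ENNReal.ofReal_le_ofReal ?_
    rw [edgePt_one, edgePt_of_nonpos i j le_rfl]
    simp only [Psi_corner, cornerH_apply, if_neg hij, if_neg hij.symm, if_true]
    linarith

/-! ### Rectifiable paths -/

/-- A first digit of a point of the gasket. -/
def digit (x : SG) : Fin 3 := (exists_F_eq x).choose

/-- The remainder of a point after removal of its first digit. -/
def rest (x : SG) : SG := (exists_F_eq x).choose_spec.choose

theorem F_digit_rest (x : SG) : F (digit x) (rest x) = x :=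
  (exists_F_eq x).choose_spec.choose_spec

/-- Paths of bounded length that start in `corner 0` and whose end points approximate `x`. -/
def approxPath : ℕ → SG → ℝ → SG
  | 0, _, _ => corner 0
  | n + 1, x, t =>
    if t ≤ 1 / 2 then edgePt 0 (digit x) t else F (digit x) (approxPath n (rest x) (2 * t - 1))

theorem approxPath_of_nonpos (n : ℕ) (x : SG) {t : ℝ} (ht : t ≤ 0) :
    approxPath n x t = corner 0 := by
  cases n with
  | zero => rfl
  | succ n => rw [approxPath, if_pos (by linarith), edgePt_of_nonpos _ _ ht]

/-- The two branches meet at time 1/2 because the edge midpoint is `F (digit x) (corner 0)`, where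
the scaled path starts. -/
theorem approxPath_succ_of_ge (n : ℕ) (x : SG) {t : ℝ} (ht : 1 / 2 ≤ t) :
    approxPath (n + 1) x t = F (digit x) (approxPath n (rest x) (2 * t - 1)) := by
  rcases eq_or_lt_of_le ht with rfl | h
  · rw [approxPath, if_pos le_rfl, edgePt_second_half _ _ ⟨le_rfl, by norm_num⟩,
      approxPath_of_nonpos _ _ (by norm_num), edgePt_of_nonpos _ _ (by norm_num)]
  · rw [approxPath, if_neg (not_le.2 h)]

theorem continuous_approxPath (n : ℕ) (x : SG) : Continuous (approxPath n x) := by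
  induction n generalizing x with
  | zero => exact continuous_const
  | succ n ih =>
    refine Continuous.if_le (continuous_edgePt _ _)
      ((continuous_F _).comp ((ih _).comp (by fun_prop))) continuous_id continuous_const ?_
    rintro t (rfl : t = 1 / 2)
    rw [← approxPath_succ_of_ge n x le_rfl, approxPath, if_pos le_rfl]

theorem dist_approxPath_succ_le (n : ℕ) (x : SG) (t : ℝ) :
    dist (approxPath n x t) (approxPath (n + 1) x t) ≤ diamSG * (1 / 2) ^ n := by
  induction n generalizing x t with
  | zero => simpa using dist_le_diamSG _ _
  | succ n ih =>
    rcases le_total t (1 / 2) with h | h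
    · rw [approxPath, approxPath, if_pos h, if_pos h, dist_self]
      exact mul_nonneg Metric.diam_nonneg (by positivity)
    · rw [approxPath_succ_of_ge _ _ h, approxPath_succ_of_ge _ _ h, dist_F, pow_succ]
      linarith [ih (rest x) (2 * t - 1)]

theorem dist_approxPath_one_le (n : ℕ) (x : SG) :
    dist (approxPath n x 1) x ≤ (1 / 2) ^ n * diamSG := by
  induction n generalizing x with
  | zero => simpa using dist_le_diamSG _ _
  | succ n ih =>
    rw [approxPath_succ_of_ge _ _ (by norm_num)]
    nth_rw 3 [← F_digit_rest x]
    rw [dist_F, pow_succ]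
    norm_num
    linarith [ih (rest x)]

theorem eVariationOn_Psi_approxPath_le (n : ℕ) (x : SG) :
    eVariationOn (fun t => Psi (approxPath n x t)) (Icc 0 1) ≤ 10 := by
  induction n generalizing x with
  | zero =>
    have h0 : eVariationOn (fun t => Psi (approxPath 0 x t)) (Icc 0 1) = 0 := by
      refine eVariationOn.constant_on ?_
      rintro _ ⟨s, -, rfl⟩ _ ⟨t, -, rfl⟩
      rfl
    rw [h0]
    exact zero_le
  | succ n ih =>
    have hadd := eVariationOn.Icc_add_Icc (fun t => Psi (approxPath (n + 1) x t)) (s := univ)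
      (by norm_num : (0 : ℝ) ≤ 1 / 2) (by norm_num : (1 / 2 : ℝ) ≤ 1) (mem_univ _)
    simp only [univ_inter] at hadd
    have h1 : eVariationOn (fun t => Psi (approxPath (n + 1) x t)) (Icc 0 (1 / 2)) ≤ 4 := by
      have : EqOn (fun t => Psi (approxPath (n + 1) x t)) (fun t => Psi (edgePt 0 (digit x) t))
          (Icc 0 (1 / 2)) := fun t ht => by
        simp only [approxPath, if_pos ht.2]
      rw [eVariationOn.congr this]
      exact (eVariationOn.mono _ (Icc_subset_Icc_right (by norm_num))).trans
        (eVariationOn_Psi_edgePt_le _ _)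
    have h2 : eVariationOn (fun t => Psi (approxPath (n + 1) x t)) (Icc (1 / 2) 1) ≤
        ((3 / 5 : NNReal) : ℝ≥0∞) * 10 := by
      have : EqOn (fun t => Psi (approxPath (n + 1) x t))
          (H (digit x) ∘ fun t => (fun s => Psi (approxPath n (rest x) s)) (2 * t - 1))
          (Icc (1 / 2) 1) := fun t ht => by
        simp only [approxPath_succ_of_ge n x ht.1, Psi_F, Function.comp]
      rw [eVariationOn.congr this]
      refine (((lipschitzWith_H _).lipschitzOnWith (s := univ)).comp_eVariationOn_le
        (mapsTo_univ _ _)).trans ?_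
      gcongr
      refine le_trans ?_ (ih (rest x))
      exact eVariationOn.comp_le_of_monotoneOn (t := Icc (1 / 2 : ℝ) 1)
        (fun s => Psi (approxPath n (rest x) s)) (fun t : ℝ => 2 * t - 1)
        (fun s _ t _ hst => by simpa using hst)
        (fun t ht => ⟨by linarith [ht.1], by linarith [ht.2]⟩)
    rw [← hadd]
    -- The bound 10 is the fixed point of L ↦ 4 + (3/5) L.
    refine (add_le_add h1 h2).trans (le_of_eq ?_)
    have : (4 + 3 / 5 * 10 : NNReal) = 10 := by
      rw [← NNReal.coe_inj]; norm_num
    exact_mod_cast congrArg ((↑) : NNReal → ℝ≥0∞) this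

theorem geodesicEDist_corner_le (x : SG) :
    geodesicEDist (range Phi) (Psi (corner 0)) (Psi x) ≤ 10 := by
  obtain ⟨γ, hγ, hlim⟩ := exists_continuous_limit (fun n => approxPath n x)
    (fun n => continuous_approxPath n x) fun n t => dist_approxPath_succ_le n x t
  have h0 : γ 0 = corner 0 := by
    refine tendsto_nhds_unique (hlim 0) ?_
    simp only [approxPath_of_nonpos _ x le_rfl]
    exact tendsto_const_nhds
  have h1 : γ 1 = x := by
    refine tendsto_nhds_unique (hlim 1) (tendsto_iff_dist_tendsto_zero.2 ?_)
    exact squeeze_zero (fun _ => dist_nonneg) (fun n => dist_approxPath_one_le n x)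
      (tendsto_half_pow_mul diamSG)
  have hle : geodesicEDist (range Phi) (Psi (corner 0)) (Psi x) ≤
      eVariationOn (fun t => Psi (γ t)) (Icc 0 1) :=
    sInf_le ⟨fun t => Psi (γ t), 0, 1, zero_le_one, (Psi.continuous.comp hγ).continuousOn,
      fun t _ => ⟨γ t, by rw [Phi_eq_Psi]⟩, by simp only [h0], by simp only [h1], rfl⟩
  refine hle.trans ?_
  refine le_of_forall_lt fun v hv => ?_
  -- Variation is lower semicontinuous under pointwise convergence, so the limit curve inherits the
  -- bound.
  obtain ⟨n, hn⟩ := (eVariationOn.lowerSemicontinuous_aux (p := atTop)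
    (F := fun n t => Psi (approxPath n x t))
    (fun t _ => (Psi.continuous.tendsto _).comp (hlim t)) hv).exists
  exact hn.trans_le (eVariationOn_Psi_approxPath_le n x)

/-! ### The geodesic metric -/

theorem Phi_F (j : Fin 3) (x : SG) : Phi (F j x) = H j (Phi x) := by
  rw [Phi_eq_Psi]
  exact Psi_F j x

theorem mapsTo_H (j : Fin 3) : MapsTo (H j) (range Phi) (range Phi) := by
  rintro _ ⟨x, rfl⟩
  exact ⟨F j x, Phi_F j x⟩

theorem geodesicEDist_H_le (j : Fin 3) (x y : E3) :
    geodesicEDist (range Phi) (H j x) (H j y) ≤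
      ((3 / 5 : NNReal) : ℝ≥0∞) * geodesicEDist (range Phi) x y := by
  rw [← ENNReal.div_le_iff' (by simp) ENNReal.coe_ne_top]
  refine le_sInf ?_
  rintro L ⟨γ, a, b, hab, hc, hm, rfl, rfl, rfl⟩
  rw [ENNReal.div_le_iff' (by simp) ENNReal.coe_ne_top]
  have hle : geodesicEDist (range Phi) (H j (γ a)) (H j (γ b)) ≤
      eVariationOn (H j ∘ γ) (Icc a b) :=
    sInf_le ⟨H j ∘ γ, a, b, hab, (lipschitzWith_H j).continuous.comp_continuousOn hc,
      (mapsTo_H j).comp hm, rfl, rfl, rfl⟩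
  refine hle.trans ?_
  exact ((lipschitzWith_H j).lipschitzOnWith (s := univ)).comp_eVariationOn_le (mapsTo_univ _ _)

theorem edist_toKH_F_le (j : Fin 3) (x y : SG) :
    edist (toKH (F j x)) (toKH (F j y)) ≤ ((3 / 5 : NNReal) : ℝ≥0∞) * edist (toKH x) (toKH y) := by
  change geodesicEDist (range Phi) (Phi (F j x)) (Phi (F j y)) ≤ _
  rw [Phi_F, Phi_F]
  exact geodesicEDist_H_le j _ _

theorem edist_toKH_le (x y : SG) : edist (toKH x) (toKH y) ≤ 20 := by
  have h : ∀ x, edist (toKH (corner 0)) (toKH x) ≤ 10 := fun x => by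
    change geodesicEDist (range Phi) (Phi (corner 0)) (Phi x) ≤ _
    have := geodesicEDist_corner_le x
    rwa [← Phi_eq_Psi] at this
  refine (edist_triangle_left _ _ (toKH (corner 0))).trans ((add_le_add (h x) (h y)).trans ?_)
  norm_num

theorem edist_toKH_FW_le {n : ℕ} (w : Fin n → Fin 3) (x y : SG) :
    edist (toKH (FW n w x)) (toKH (FW n w y)) ≤ ((3 / 5 : NNReal) : ℝ≥0∞) ^ n * 20 := by
  induction n with
  | zero => simpa [FW] using edist_toKH_le x y
  | succ n ih =>
    refine (edist_toKH_F_le _ _ _).trans ?_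
    rw [pow_succ', mul_assoc]
    gcongr
    exact ih _

/-- There are finitely many closed cells of level n, so a neighbourhood of `x` avoids all those not
containing `x`. -/
theorem eventually_common_cell (n : ℕ) (x : SG) :
    ∀ᶠ y in 𝓝 x, ∃ (w : Fin n → Fin 3) (x' y' : SG), FW n w x' = x ∧ FW n w y' = y := by
  have h : ∀ᶠ y in 𝓝 x, ∀ w : Fin n → Fin 3, y ∈ range (FW n w) → x ∈ range (FW n w) := by
    refine eventually_all.2 fun w => ?_
    by_cases hx : x ∈ range (FW n w)
    · exact Eventually.of_forall fun _ _ => hx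
    · have hc : IsClosed (range (FW n w)) := (isCompact_range (continuous_FW w)).isClosed
      filter_upwards [hc.isOpen_compl.mem_nhds hx] with y hy hy'
      exact absurd hy' hy
  filter_upwards [h] with y hy
  obtain ⟨w, y', hy'⟩ := exists_FW_eq n y
  obtain ⟨x', hx'⟩ := hy w ⟨y', hy'⟩
  exact ⟨w, x', y', hx', hy'⟩

theorem continuous_toKH : Continuous toKH := by
  refine continuous_iff_continuousAt.2 fun x => EMetric.tendsto_nhds.2 fun ε hε => ?_
  have hlim : Tendsto (fun n : ℕ => ((3 / 5 : NNReal) : ℝ≥0∞) ^ n * 20) atTop (𝓝 0) := by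
    have h1 : ((3 / 5 : NNReal) : ℝ≥0∞) < 1 := by
      rw [ENNReal.coe_lt_one_iff, ← NNReal.coe_lt_coe]
      norm_num
    simpa using ENNReal.Tendsto.mul_const (b := 20)
      (ENNReal.tendsto_pow_atTop_nhds_zero_of_lt_one h1) (Or.inr (by simp))
  obtain ⟨n, hn⟩ := (hlim.eventually (gt_mem_nhds hε)).exists
  filter_upwards [eventually_common_cell n x] with y hy
  obtain ⟨w, x', y', rfl, rfl⟩ := hy
  exact (edist_toKH_FW_le w y' x').trans_lt hn

theorem surjective_toKH : Function.Surjective toKH := by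
  rintro ⟨_, x, rfl⟩
  exact ⟨x, rfl⟩

instance : CompactSpace KH :=
  ⟨by rw [← surjective_toKH.range_eq]; exact isCompact_range continuous_toKH⟩

/-- The maps `H j`, as continuous maps of the harmonic gasket. -/
def HKH (j : Fin 3) : C(KH, KH) where
  toFun y := ⟨H j y.pt, mapsTo_H j y.mem⟩
  continuous_toFun :=
    LipschitzWith.continuous (K := 3 / 5) fun x y => geodesicEDist_H_le j x.pt y.pt

theorem HKH_toKH (j : Fin 3) (x : SG) : HKH j (toKH x) = toKH (F j x) := by
  simp only [HKH, toKH, ContinuousMap.coe_mk, Phi_F]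

/-! ### The Hausdorff measure is finite -/

theorem logb_two_three_pos : 0 < Real.logb 2 3 := Real.logb_pos (by norm_num) (by norm_num)

theorem half_rpow_logb : (2⁻¹ : ℝ≥0∞) ^ Real.logb 2 3 = 3⁻¹ := by
  rw [ENNReal.inv_rpow]
  congr 1
  rw [show (2 : ℝ≥0∞) = ENNReal.ofReal 2 by simp, ENNReal.ofReal_rpow_of_pos (by norm_num),
    Real.rpow_logb (by norm_num) (by norm_num) (by norm_num)]
  simp

theorem half_pow_rpow_logb (n : ℕ) : ((2⁻¹ : ℝ≥0∞) ^ n) ^ Real.logb 2 3 = 3⁻¹ ^ n := by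
  rw [← half_rpow_logb, ← ENNReal.rpow_natCast, ← ENNReal.rpow_natCast, ← ENNReal.rpow_mul,
    ← ENNReal.rpow_mul, mul_comm]

theorem ediam_range_FW_le {n : ℕ} (w : Fin n → Fin 3) :
    Metric.ediam (range (FW n w)) ≤ 2⁻¹ ^ n * ENNReal.ofReal diamSG := by
  refine Metric.ediam_le ?_
  rintro _ ⟨x, rfl⟩ _ ⟨y, rfl⟩
  have h2 : (2⁻¹ : ℝ≥0∞) ^ n = ENNReal.ofReal ((1 / 2) ^ n) := by
    rw [ENNReal.ofReal_pow (by norm_num), one_div, ENNReal.ofReal_inv_of_pos (by norm_num)]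
    simp
  rw [edist_dist, dist_FW, h2, ← ENNReal.ofReal_mul (by positivity)]
  exact ENNReal.ofReal_le_ofReal
    (mul_le_mul_of_nonneg_left (dist_le_diamSG x y) (by positivity))

theorem hausdorffMeasure_univ_ne_top : μH[Real.logb 2 3] (univ : Set SG) ≠ ∞ := by
  set s := Real.logb 2 3
  have hs : 0 < s := logb_two_three_pos
  have hr : Tendsto (fun n : ℕ => (2⁻¹ : ℝ≥0∞) ^ n * ENNReal.ofReal diamSG) atTop (𝓝 0) := by
    simpa using ENNReal.Tendsto.mul_const (b := ENNReal.ofReal diamSG)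
      (ENNReal.tendsto_pow_atTop_nhds_zero_of_lt_one (by simp : (2⁻¹ : ℝ≥0∞) < 1))
      (Or.inr (by simp))
  have h := Measure.hausdorffMeasure_le_liminf_sum s (univ : Set SG) _ hr
    (fun n (w : Fin n → Fin 3) => range (FW n w))
    (Eventually.of_forall fun n w => ediam_range_FW_le w)
    (Eventually.of_forall fun n x _ => by
      obtain ⟨w, y, rfl⟩ := exists_FW_eq n x
      exact mem_iUnion.2 ⟨w, y, rfl⟩)
  -- With s = log₂ 3, the 3^n cells of diameter at most 2^(-n) D contribute at most D^s in total,
  -- for every n.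
  refine ne_top_of_le_ne_top (b := ENNReal.ofReal diamSG ^ s) (by simp [hs.le]) (h.trans ?_)
  refine (liminf_le_liminf (Eventually.of_forall fun n => ?_)).trans
    (liminf_const (f := (atTop : Filter ℕ)) (ENNReal.ofReal diamSG ^ s)).le
  calc ∑ w : Fin n → Fin 3, Metric.ediam (range (FW n w)) ^ s
      ≤ ∑ _w : Fin n → Fin 3, 3⁻¹ ^ n * ENNReal.ofReal diamSG ^ s :=
        Finset.sum_le_sum fun w _ => by
          rw [← half_pow_rpow_logb, ← ENNReal.mul_rpow_of_nonneg _ _ hs.le]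
          exact ENNReal.rpow_le_rpow (ediam_range_FW_le w) hs.le
    _ = ENNReal.ofReal diamSG ^ s := by
        rw [Finset.sum_const, Finset.card_univ, Fintype.card_fun, Fintype.card_fin,
          Fintype.card_fin, nsmul_eq_mul, ← mul_assoc, Nat.cast_pow, ← mul_pow]
        rw [show ((3 : ℕ) : ℝ≥0∞) = 3 by norm_num, ENNReal.mul_inv_cancel (by simp) (by simp),
          one_pow, one_mul]

/-! ### The Hausdorff measure is positive -/

/-- The shift on infinite words. -/
def shift (ω : ℕ → Fin 3) : ℕ → Fin 3 := fun n => ω (n + 1)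

theorem continuous_shift : Continuous shift := by
  unfold shift
  fun_prop

/-- Approximations of the point with a given infinite word. -/
def approxCoding : ℕ → (ℕ → Fin 3) → SG
  | 0, _ => corner 0
  | n + 1, ω => F (ω 0) (approxCoding n (shift ω))

theorem continuous_approxCoding (n : ℕ) : Continuous (approxCoding n) := by
  induction n with
  | zero => exact continuous_const
  | succ n ih =>
    have h : Continuous fun a : Fin 3 × SG => F a.1 a.2 :=
      continuous_prod_of_discrete_left.2 continuous_F
    have h2 : Continuous fun ω : ℕ → Fin 3 => (ω 0, approxCoding n (shift ω)) :=
      (continuous_apply 0).prodMk (ih.comp continuous_shift)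
    have h3 : approxCoding (n + 1) = fun ω => F (ω 0) (approxCoding n (shift ω)) := by
      funext ω
      rw [approxCoding]
    have h4 := h.comp h2
    rw [h3]
    exact h4

theorem dist_approxCoding_succ_le (n : ℕ) (ω : ℕ → Fin 3) :
    dist (approxCoding n ω) (approxCoding (n + 1) ω) ≤ diamSG * (1 / 2) ^ n := by
  induction n generalizing ω with
  | zero => simpa using dist_le_diamSG _ _
  | succ n ih =>
    rw [approxCoding, approxCoding, dist_F, pow_succ]
    linarith [ih (shift ω)]

theorem exists_coding : ∃ π : (ℕ → Fin 3) → SG, Continuous π ∧ ∀ ω, π ω = F (ω 0) (π (shift ω)) := by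
  obtain ⟨π, hπ, hlim⟩ := exists_continuous_limit approxCoding continuous_approxCoding
    dist_approxCoding_succ_le
  refine ⟨π, hπ, fun ω => tendsto_nhds_unique ((tendsto_add_atTop_iff_nat 1).2 (hlim ω)) ?_⟩
  exact ((continuous_F _).tendsto _).comp (hlim (shift ω))

/-- The number whose binary digits tell where the letter `k` occurs among the first `n` letters. -/
def prefixNumber (k : Fin 3) (ω : ℕ → Fin 3) : ℕ → ℕ
  | 0 => 0
  | n + 1 => 2 * prefixNumber k ω n + if ω n = k then 1 else 0

/-- The parities of the three numbers reveal the last letter; halving reduces to shorter prefixes.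
-/
theorem prefixNumber_injective {n : ℕ} {ω ω' : ℕ → Fin 3}
    (h : ∀ k, prefixNumber k ω n = prefixNumber k ω' n) : ∀ m < n, ω m = ω' m := by
  induction n with
  | zero => intro m hm; omega
  | succ n ih =>
    have h1 : ∀ k, prefixNumber k ω n = prefixNumber k ω' n ∧ (ω n = k ↔ ω' n = k) := fun k => by
      have := h k
      simp only [prefixNumber] at this
      split_ifs at this with h1 h2 h2 <;> simp only [h1, h2] <;> simp <;> omega
    intro m hm
    rcases Nat.lt_succ_iff_lt_or_eq.1 hm with hm | rfl
    · exact ih (fun k => (h1 k).1) m hm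
    · exact ((h1 _).2.1 rfl).symm

/-- The k-th coordinate has a binary expansion with digit 1 exactly where the word has the letter
`k`; `prefixNumber` is its truncation. -/
theorem bary_coding {π : (ℕ → Fin 3) → SG} (hπ : ∀ ω, π ω = F (ω 0) (π (shift ω)))
    (k : Fin 3) (ω : ℕ → Fin 3) (n : ℕ) :
    2 ^ n * bary k (π ω) = prefixNumber k ω n + bary k (π (shift^[n] ω)) := by
  induction n with
  | zero => simp [prefixNumber]
  | succ n ih =>
    have h0 : ∀ m, shift^[m] ω 0 = ω m := by
      intro m
      have : ∀ l, shift^[m] ω l = ω (l + m) := by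
        induction m with
        | zero => intro l; rfl
        | succ m ihm =>
          intro l
          rw [Function.iterate_succ_apply']
          change shift^[m] ω (l + 1) = _
          rw [ihm, add_right_comm, add_assoc]
      rw [this, zero_add]
    have h1 : bary k (π (shift^[n] ω)) = 1 / 2 * bary k (π (shift^[n + 1] ω)) +
        if k = ω n then 1 / 2 else 0 := by
      rw [hπ (shift^[n] ω), h0, Function.iterate_succ_apply']
      exact bary_f _ _ _
    rw [pow_succ, mul_right_comm, ih, h1, prefixNumber]
    push_cast
    simp only [eq_comm (a := k)]
    split_ifs <;> ring

/-- The scaled coordinates differ by at most 2, and the remainders, lying in [0, 1], add at most 1.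
-/
theorem abs_prefixNumber_sub_le {π : (ℕ → Fin 3) → SG} (hπ : ∀ ω, π ω = F (ω 0) (π (shift ω)))
    (k : Fin 3) {ω ω' : ℕ → Fin 3} {n : ℕ} (h : dist (π ω) (π ω') ≤ (1 / 2) ^ n) :
    |(prefixNumber k ω n : ℝ) - prefixNumber k ω' n| ≤ 3 := by
  have h01 : ∀ x : SG, 0 ≤ bary k x ∧ bary k x ≤ 1 := fun x => by
    have h0 := bary_nonneg x.2 0
    have h1 := bary_nonneg x.2 1
    have h2 := bary_nonneg x.2 2
    have hs := sum_bary x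
    refine ⟨bary_nonneg x.2 k, ?_⟩
    fin_cases k <;> simp <;> linarith
  have e := bary_coding hπ k ω n
  have e' := bary_coding hπ k ω' n
  have hb := h01 (π (shift^[n] ω))
  have hb' := h01 (π (shift^[n] ω'))
  have hl := (bary_sub_le k (π ω) (π ω')).trans (mul_le_mul_of_nonneg_left h zero_le_two)
  have hp : (0 : ℝ) < 2 ^ n := by positivity
  have hm : |2 ^ n * bary k (π ω) - 2 ^ n * bary k (π ω')| ≤ 2 := by
    rw [← mul_sub, abs_mul, abs_of_pos hp]
    calc _ ≤ (2 : ℝ) ^ n * (2 * (1 / 2) ^ n) := mul_le_mul_of_nonneg_left hl hp.le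
      _ = 2 * (2 * (1 / 2)) ^ n := by rw [mul_pow]; ring
      _ = 2 := by norm_num
  rw [abs_le] at hm ⊢
  constructor <;> linarith [hm.1, hm.2]

/-- The uniform measure on infinite words. -/
def wordMeasure : Measure (ℕ → Fin 3) :=
  Measure.infinitePi fun _ => (PMF.uniformOfFintype (Fin 3)).toMeasure

instance : IsProbabilityMeasure wordMeasure := by
  unfold wordMeasure; infer_instance

theorem wordMeasure_cylinder (n : ℕ) (ω : ℕ → Fin 3) :
    wordMeasure {ω' | ∀ m < n, ω' m = ω m} = 3⁻¹ ^ n := by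
  have h : {ω' : ℕ → Fin 3 | ∀ m < n, ω' m = ω m} =
      Set.pi (Finset.range n : Finset ℕ) fun m => {ω m} := by
    ext; simp [Set.mem_pi]
  rw [h, wordMeasure, Measure.infinitePi_pi _ fun _ _ => measurableSet_singleton _]
  simp

/-- Each of the three prefix numbers has at most 7 possible values on the preimage, and a triple
determines the prefix, a cylinder of mass 3^(-n). Hence 343 = 7^3. -/
theorem wordMeasure_preimage_le {π : (ℕ → Fin 3) → SG} (hπ : ∀ ω, π ω = F (ω 0) (π (shift ω)))
    {A : Set SG} {n : ℕ} (hA : Metric.ediam A ≤ 2⁻¹ ^ n) :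
    wordMeasure (π ⁻¹' A) ≤ 343 * 3⁻¹ ^ n := by
  rcases (π ⁻¹' A).eq_empty_or_nonempty with h | ⟨ω₀, h₀⟩
  · rw [h, measure_empty]
    exact zero_le
  have hd : ∀ ω ∈ π ⁻¹' A, dist (π ω) (π ω₀) ≤ (1 / 2) ^ n := fun ω hω => by
    have h := (Metric.edist_le_ediam_of_mem (mem_preimage.1 hω) h₀).trans hA
    rw [edist_dist] at h
    have h2 : (2⁻¹ : ℝ≥0∞) ^ n = ENNReal.ofReal ((1 / 2) ^ n) := by
      rw [ENNReal.ofReal_pow (by norm_num), one_div, ENNReal.ofReal_inv_of_pos (by norm_num)]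
      simp
    rw [h2] at h
    exact (ENNReal.ofReal_le_ofReal_iff (by positivity)).1 h
  let N : (ℕ → Fin 3) → Fin 3 → ℤ := fun ω k => prefixNumber k ω n
  let B : Finset (Fin 3 → ℤ) := Fintype.piFinset fun k => Finset.Icc (N ω₀ k - 3) (N ω₀ k + 3)
  have hcard : B.card = 343 := by
    simp only [B, Fintype.card_piFinset, Int.card_Icc, Fin.prod_univ_three]
    have : ∀ z : ℤ, (z + 3 + 1 - (z - 3)).toNat = 7 := fun z => by
      rw [show z + 3 + 1 - (z - 3) = 7 by ring]; rfl
    norm_num [this]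
  have hsub : π ⁻¹' A ⊆ ⋃ b ∈ B, {ω | N ω = b} := fun ω hω => by
    simp only [mem_iUnion]
    refine ⟨N ω, Fintype.mem_piFinset.2 fun k => ?_, rfl⟩
    have := abs_prefixNumber_sub_le hπ k (hd ω hω)
    rw [abs_le] at this
    have h1 : (-3 : ℤ) ≤ N ω k - N ω₀ k := by
      change (-3 : ℤ) ≤ (prefixNumber k ω n : ℤ) - prefixNumber k ω₀ n
      exact_mod_cast this.1
    have h2 : N ω k - N ω₀ k ≤ (3 : ℤ) := by
      change (prefixNumber k ω n : ℤ) - prefixNumber k ω₀ n ≤ 3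
      exact_mod_cast this.2
    rw [Finset.mem_Icc]
    constructor <;> linarith
  have hfib : ∀ b, wordMeasure {ω | N ω = b} ≤ 3⁻¹ ^ n := fun b => by
    rcases {ω | N ω = b}.eq_empty_or_nonempty with h | ⟨ω₁, rfl⟩
    · rw [h, measure_empty]
      exact zero_le
    · rw [← wordMeasure_cylinder n ω₁]
      refine measure_mono fun ω hω => ?_
      refine prefixNumber_injective fun k => ?_
      have := congrFun (show N ω = N ω₁ from hω) k
      exact Int.ofNat_inj.1 this
  calc wordMeasure (π ⁻¹' A) ≤ wordMeasure (⋃ b ∈ B, {ω | N ω = b}) := measure_mono hsub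
    _ ≤ ∑ b ∈ B, wordMeasure {ω | N ω = b} := measure_biUnion_finset_le _ _
    _ ≤ ∑ _b ∈ B, 3⁻¹ ^ n := Finset.sum_le_sum fun b _ => hfib b
    _ = 343 * 3⁻¹ ^ n := by rw [Finset.sum_const, hcard, nsmul_eq_mul]; norm_num

/-- Mass distribution principle: for 2^(-(n+1)) < diam A ≤ 2^(-n) the image measure of A is at most
343 · 3^(-n) = 1029 · 3^(-(n+1)) ≤ 1029 (diam A)^s. -/
theorem hausdorffMeasure_univ_ne_zero : μH[Real.logb 2 3] (univ : Set SG) ≠ 0 := by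
  obtain ⟨π, hπc, hπ⟩ := exists_coding
  set s := Real.logb 2 3
  have hs : 0 < s := logb_two_three_pos
  let m : Measure SG := (1029⁻¹ : ℝ≥0∞) • wordMeasure.map π
  have hle : m ≤ μH[s] := by
    have hclosed : ∀ A : Set SG, IsClosed A → Metric.ediam A ≤ 1 → m A ≤ Metric.ediam A ^ s := by
      intro A hAc hA
      have hm : m A = 1029⁻¹ * wordMeasure (π ⁻¹' A) := by
        simp only [m, Measure.smul_apply, smul_eq_mul,
          Measure.map_apply hπc.measurable hAc.measurableSet]
      rw [hm, ENNReal.inv_mul_le_iff (by norm_num) (by norm_num)]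
      by_cases h0 : Metric.ediam A = 0
      · have hlim : Tendsto (fun n : ℕ => (343 : ℝ≥0∞) * 3⁻¹ ^ n) atTop (𝓝 0) := by
          simpa using ENNReal.Tendsto.const_mul (a := 343)
            (ENNReal.tendsto_pow_atTop_nhds_zero_of_lt_one
              (ENNReal.inv_lt_one.2 (by norm_num) : (3⁻¹ : ℝ≥0∞) < 1)) (Or.inr (by norm_num))
        refine (ge_of_tendsto' hlim fun n => wordMeasure_preimage_le hπ ?_).trans zero_le
        rw [h0]
        exact zero_le
      · obtain ⟨n, hn1, hn2⟩ : ∃ n : ℕ, (2⁻¹ : ℝ≥0∞) ^ (n + 1) < Metric.ediam A ∧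
            Metric.ediam A ≤ 2⁻¹ ^ n := by
          have hlim : ∃ n : ℕ, (2⁻¹ : ℝ≥0∞) ^ n < Metric.ediam A :=
            ((ENNReal.tendsto_pow_atTop_nhds_zero_of_lt_one (by simp : (2⁻¹ : ℝ≥0∞) < 1)).eventually
              (gt_mem_nhds (pos_iff_ne_zero.2 h0))).exists
          classical
          have hn := Nat.find_spec hlim
          have hpos : Nat.find hlim ≠ 0 := fun h => by
            rw [h, pow_zero] at hn
            exact absurd hA (not_le.2 hn)
          obtain ⟨k, hk⟩ := Nat.exists_eq_succ_of_ne_zero hpos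
          refine ⟨k, by rw [← Nat.succ_eq_add_one, ← hk]; exact hn, not_lt.1 ?_⟩
          exact Nat.find_min hlim (by omega)
        refine (wordMeasure_preimage_le hπ hn2).trans ?_
        calc (343 : ℝ≥0∞) * 3⁻¹ ^ n = 1029 * 3⁻¹ ^ (n + 1) := by
              rw [show (1029 : ℝ≥0∞) = 343 * 3 by norm_num, pow_succ', mul_assoc, ← mul_assoc 3,
                ENNReal.mul_inv_cancel (by simp) (by simp), one_mul]
          _ = 1029 * ((2⁻¹ : ℝ≥0∞) ^ (n + 1)) ^ s := by rw [half_pow_rpow_logb]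
          _ ≤ 1029 * Metric.ediam A ^ s := by gcongr
    refine Measure.le_hausdorffMeasure s m 1 one_pos fun A hA => ?_
    -- Passing to the closure gains measurability without changing the diameter.
    refine (measure_mono subset_closure).trans ?_
    have := hclosed (closure A) isClosed_closure (by rwa [Metric.ediam_closure])
    rwa [Metric.ediam_closure] at this
  have h1 : m univ = 1029⁻¹ := by
    simp [m, Measure.map_apply hπc.measurable MeasurableSet.univ]
  intro h
  have := hle univ
  rw [h, h1, nonpos_iff_eq_zero, ENNReal.inv_eq_zero] at this
  exact absurd this (by norm_num)

/-! ### Self-similarity of the Hausdorff measure -/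

instance : IsProbabilityMeasure hausdorffProb := by
  refine ⟨?_⟩
  rw [hausdorffProb, Measure.smul_apply, smul_eq_mul]
  exact ENNReal.inv_mul_cancel hausdorffMeasure_univ_ne_zero hausdorffMeasure_univ_ne_top

theorem hausdorffMeasure_inter_range_F_le (j : Fin 3) (A : Set SG) :
    μH[Real.logb 2 3] (A ∩ range (F j)) ≤ 3⁻¹ * μH[Real.logb 2 3] (F j ⁻¹' A) := by
  rw [← image_preimage_eq_inter_range, ← half_rpow_logb]
  have h := (lipschitzWith_F j).hausdorffMeasure_image_le logb_two_three_pos.le (F j ⁻¹' A)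
  have h2 : (((1 / 2 : NNReal)) : ℝ≥0∞) = 2⁻¹ := by
    rw [one_div, ENNReal.coe_inv (by norm_num)]; rfl
  rwa [h2] at h

/-- Subadditivity and the Lipschitz bound give one inequality; equal total masses turn it into
equality, without examining overlaps of cells. -/
theorem hausdorffProb_eq :
    hausdorffProb = (3⁻¹ : ℝ≥0∞) • ∑ j, hausdorffProb.map (F j) := by
  have hm : ∀ j, Measurable (F j) := fun j => (continuous_F j).measurable
  have : ∀ j, IsProbabilityMeasure (hausdorffProb.map (F j)) := fun j =>
    Measure.isProbabilityMeasure_map (hm j).aemeasurable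
  refine Measure.eq_of_le_of_measure_univ_eq (Measure.le_iff.2 fun A hA => ?_) ?_
  · have hcov : A ⊆ ⋃ j, A ∩ range (F j) := fun x hx => by
      obtain ⟨j, y, h⟩ := exists_F_eq x
      exact mem_iUnion.2 ⟨j, hx, y, h⟩
    simp only [Measure.smul_apply, Measure.finsetSum_apply, smul_eq_mul,
      Measure.map_apply (hm _) hA, Finset.mul_sum]
    refine (measure_mono hcov).trans ((measure_iUnion_fintype_le _ _).trans
      (Finset.sum_le_sum fun j _ => ?_))
    simp only [hausdorffProb, Measure.smul_apply, smul_eq_mul]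
    rw [mul_left_comm]
    gcongr
    exact hausdorffMeasure_inter_range_F_le j A
  · simp only [Measure.smul_apply, Measure.finsetSum_apply, smul_eq_mul, measure_univ]
    simp [ENNReal.inv_mul_cancel]

/-! ### Integrals and midpoint averages -/

theorem integrable_of_continuous {g : SG → ℂ} (hg : Continuous g) : Integrable g hausdorffProb := by
  have := hg.continuousOn.integrableOn_compact (μ := hausdorffProb) (K := univ) isCompact_univ
  rwa [integrableOn_univ] at this

theorem integral_eq_sum_F {g : SG → ℂ} (hg : Continuous g) :
    ∫ x, g x ∂hausdorffProb = 1 / 3 * ∑ j, ∫ x, g (F j x) ∂hausdorffProb := by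
  have hm : ∀ j, AEMeasurable (F j) hausdorffProb := fun j =>
    (continuous_F j).measurable.aemeasurable
  conv_lhs => rw [hausdorffProb_eq]
  rw [integral_smul_measure, integral_finsetSum_measure]
  · simp only [integral_map (hm _) hg.aestronglyMeasurable]
    simp [Complex.real_smul]
  · intro j _
    rw [integrable_map_measure hg.aestronglyMeasurable (hm j)]
    exact integrable_of_continuous (hg.comp (continuous_F j))

theorem psi_succ (n : ℕ) (g : SG → ℂ) : psi (n + 1) g = 1 / 3 * ∑ j, psi n fun x => g (F j x) := by
  simp only [psi, ← Finset.mul_sum, edgeMidpoint_eq]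
  rw [← (Fin.snocEquiv fun _ : Fin (n + 1) => Fin 3).sum_comp, Fintype.sum_prod_type]
  have h : ∀ j w, (Fin.snocEquiv fun _ : Fin (n + 1) => Fin 3) (j, w) = Fin.snoc w j :=
    fun _ _ => rfl
  simp only [h, FW_snoc]
  rw [← mul_assoc]
  congr 1
  rw [pow_succ 3 (n + 1)]
  ring

/-- Integral and average satisfy the same recursion over the three cells, which reduces the claim to
level 0, where a value differs from the mean by at most the oscillation. -/
theorem norm_psi_sub_integral_le (n : ℕ) {g : SG → ℂ} (hg : Continuous g) {ε : ℝ}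
    (h : ∀ (w : Fin n → Fin 3) x y, dist (g (FW n w x)) (g (FW n w y)) ≤ ε) :
    ‖psi n g - ∫ x, g x ∂hausdorffProb‖ ≤ ε := by
  induction n generalizing g with
  | zero =>
    have hb : ∀ y, ‖g y - ∫ x, g x ∂hausdorffProb‖ ≤ ε := fun y => by
      have h1 : g y - ∫ x, g x ∂hausdorffProb = ∫ x, (g y - g x) ∂hausdorffProb := by
        rw [integral_sub (integrable_const _) (integrable_of_continuous hg)]
        simp
      rw [h1]
      have := norm_integral_le_of_norm_le_const (μ := hausdorffProb) (C := ε)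
        (f := fun x => g y - g x) (Eventually.of_forall fun x => by
          rw [← dist_eq_norm]
          exact h Fin.elim0 y x)
      simpa using this
    have h2 : psi 0 g - ∫ x, g x ∂hausdorffProb =
        1 / 3 * ∑ j, (g (baseMidpoint j) - ∫ x, g x ∂hausdorffProb) := by
      simp only [psi, edgeMidpoint_eq, FW]
      simp [Fin.sum_univ_three]
      ring
    rw [h2, norm_mul]
    refine (mul_le_mul_of_nonneg_left ((norm_sum_le _ _).trans
      (Finset.sum_le_sum fun j _ => hb _)) (norm_nonneg _)).trans (le_of_eq ?_)
    simp
  | succ n ih =>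
    have hj : ∀ j, ‖psi n (fun x => g (F j x)) - ∫ x, g (F j x) ∂hausdorffProb‖ ≤ ε := fun j =>
      ih (hg.comp (continuous_F j)) fun w x y => by
        have := h (Fin.snoc w j) x y
        rwa [FW_snoc, FW_snoc] at this
    rw [psi_succ, integral_eq_sum_F hg, ← mul_sub, ← Finset.sum_sub_distrib, norm_mul]
    refine (mul_le_mul_of_nonneg_left ((norm_sum_le _ _).trans
      (Finset.sum_le_sum fun j _ => hj j)) (norm_nonneg _)).trans (le_of_eq ?_)
    simp

theorem tendsto_psi {g : SG → ℂ} (hg : Continuous g) :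
    Tendsto (fun n => psi n g) atTop (𝓝 (∫ x, g x ∂hausdorffProb)) := by
  refine Metric.tendsto_nhds.2 fun ε hε => ?_
  obtain ⟨δ, hδ, hgδ⟩ := Metric.uniformContinuous_iff.1
    (CompactSpace.uniformContinuous_of_continuous hg) (ε / 2) (half_pos hε)
  filter_upwards [(tendsto_half_pow_mul diamSG).eventually (gt_mem_nhds hδ)] with n hn
  rw [dist_eq_norm]
  refine (norm_psi_sub_integral_le n hg (ε := ε / 2) fun w x y => (hgδ ?_).le).trans_lt
    (half_lt_self hε)
  rw [dist_FW]
  exact (mul_le_mul_of_nonneg_left (dist_le_diamSG _ _) (by positivity)).trans_lt hn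

/-- Integration against the normalized Hausdorff measure, as a functional on `C(SG, ℂ)`. -/
def integralCLM : C(SG, ℂ) →L[ℂ] ℂ :=
  LinearMap.mkContinuous
    { toFun := fun g => ∫ x, g x ∂hausdorffProb
      map_add' := fun g g' => integral_add (integrable_of_continuous g.continuous)
        (integrable_of_continuous g'.continuous)
      map_smul' := fun c g => integral_const_mul c _ } 1 fun g => by
    have := norm_integral_le_of_norm_le_const (μ := hausdorffProb) (f := g)
      (Eventually.of_forall fun x => g.norm_coe_le_norm x)
    simpa using this

/-- The functional `h ↦ ∫ h ∘ Φ`. -/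
def limitFunctional : WeakDual ℂ C(KH, ℂ) :=
  StrongDual.toWeakDual
    (integralCLM.comp (ContinuousMap.compCLM ℂ ℂ ⟨toKH, continuous_toKH⟩))

theorem limitFunctional_apply (h : C(KH, ℂ)) :
    limitFunctional h = ∫ x, h (toKH x) ∂hausdorffProb := rfl

end HarmonicGasket

end

theorem mainTheorem12 :
    ∃ (psiLim : WeakDual ℂ C(HarmonicGasket.KH, ℂ))
      (G : Fin 3 → C(HarmonicGasket.KH, HarmonicGasket.KH)),
      (∀ h : C(HarmonicGasket.KH, ℂ),
        Integrable (fun x => h (HarmonicGasket.toKH x)) HarmonicGasket.hausdorffProb ∧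
        psiLim h = ∫ x, h (HarmonicGasket.toKH x) ∂HarmonicGasket.hausdorffProb ∧
        psiLim h = ∫ y, h y ∂(HarmonicGasket.hausdorffProb.map HarmonicGasket.toKH)) ∧
      (∀ h : C(HarmonicGasket.KH, ℂ), (∀ y, 0 ≤ h y) → 0 ≤ psiLim h) ∧
      Tendsto HarmonicGasket.psiTilde atTop (𝓝 psiLim) ∧
      (∀ j y, (G j y).pt = HarmonicGasket.H j y.pt) ∧
      (∀ h : C(HarmonicGasket.KH, ℂ), psiLim h = 1 / 3 * ∑ j, psiLim (h.comp (G j))) := by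
  open HarmonicGasket in
  have hc : ∀ h : C(KH, ℂ), Continuous fun x => h (toKH x) := fun h =>
    h.continuous.comp continuous_toKH
  open HarmonicGasket in
  refine ⟨limitFunctional, HKH, fun h => ⟨integrable_of_continuous (hc h), rfl, ?_⟩,
    fun h hh => ?_, ?_, fun j y => rfl, fun h => ?_⟩
  · rw [integral_map continuous_toKH.measurable.aemeasurable h.continuous.aestronglyMeasurable]
    rfl
  · exact integral_nonneg fun x => hh (toKH x)
  · refine tendsto_iff_forall_eval_tendsto_topDualPairing.2 fun h => ?_
    change Tendsto (fun n => psiTilde n h) atTop (𝓝 (limitFunctional h))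
    simp only [psiTilde_apply]
    exact tendsto_psi (hc h)
  -- The conjugacy of `H j` with `F j` reduces invariance to the self-similarity of the Hausdorff
  -- measure.
  · simp only [limitFunctional_apply, ContinuousMap.comp_apply, HKH_toKH]
    exact integral_eq_sum_F (hc h)
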